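/- Let $n\ge 1$, let $\mathbb{B}^n\subset\mathbb{C}^n$ be the open unit ball and let $SU(n,1)=\{A\in SL(n+1,\mathbb{C}) : A^T\sigma\bar A=\sigma\}$, $\sigma=\mathrm{diag}(1,\dots,1,-1)$, act on $\mathbb{B}^n$ by fractional-linear transformations, with complex Jacobian $J(\gamma,z)=(a_{n+1,1}z_1+\dots+a_{n+1,n}z_n+a_{n+1,n+1})^{-(n+1)}$ for $\gamma=(a_{jk})$. Put $\langle z,w\rangle=z_1\bar w_1+\dots+z_n\bar w_n-1$; let $\mathcal{K}(z,w)=\frac{n!}{\pi^n}(-\langle z,w\rangle)^{-(n+1)}$ be the Bergman kernel, $dV(z)=\mathcal{K}(z,z)\,dV_e(z)$ with $dV_e$ the Lebesgue measure, and let $\tau$ be the complex hyperbolic distance, $\cosh^2\frac{\tau(z,w)}{2}=\frac{\langle z,w\rangle\langle w,z\rangle}{\langle z,z\rangle\langle w,w\rangle}$. For $A,B\subset\mathbb{B}^n$ put $\mathrm{dist}(A,B)=\inf\{\tau(z,w): z\in A,\ w\in B\}$. For $k\ge 1$ let $c(\mathbb{B}^n,k)$ be the constant determined by $c(\mathbb{B}^n,k)\int_{\mathbb{B}^n}\mathcal{K}(0,w)^k\mathcal{K}(w,0)^k\mathcal{K}(w,w)^{-k}\,dV(w)=\mathcal{K}(0,0)^k$.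 Let $\Gamma$ be a discrete subgroup of $SU(n,1)$ with compact quotient $M=\Gamma\backslash\mathbb{B}^n$, such that every element of $\Gamma$ that fixes a point of $\mathbb{B}^n$ acts as the identity on $\mathbb{B}^n$ (so $M$ is smooth and the projection $\pi:\mathbb{B}^n\to M$ is a covering map). Let $\mathcal{F}=\{z : \tau(z,p_0)\le\tau(z,\gamma p_0)\ \forall\gamma\in\Gamma\}$ be the Dirichlet fundamental domain of $\Gamma$ centred at a point $p_0\in\mathbb{B}^n$. Let $X$ and $Y$ be embedded smooth submanifolds of $\mathbb{B}^n$, of real dimensions $q_X>0$ and $q_Y>0$, of the form $X=\pi^{-1}(X')\cap\mathcal{F}$ and $Y=\pi^{-1}(Y')\cap\mathcal{F}$, where $X',Y'$ are embedded submanifolds of $M$ of the same dimensions $q_X$, $q_Y$ and $\pi$ maps $X$ one-to-one onto $X'$ and $Y$ one-to-one onto $Y'$. Let $X$ and $Y$ be oriented, and let $\nu_X$, $\nu_Y$ be smooth real forms of degree $q_X$ on $X$ and $q_Y$ on $Y$ that are absolutely integrable and satisfy $\int_X\nu_X>0$, $\int_Y\nu_Y>0$. Denote $\tilde X=\Gamma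 X$. For a positive integer $m$, a unitary representation $\rho:\Gamma\to U(m)$, $j\in\{1,\dots,m\}$, $k\ge1$ and $p\in\mathbb{B}^n$ let $$\Theta_p^{(j;k)}(z)=c(\mathbb{B}^n,k)\sum_{\gamma\in\Gamma}J(\gamma,z)^k\,\mathcal{K}(\gamma z,p)^k\,\rho(\gamma^{-1})e_j\in\mathbb{C}^m ,$$ where $e_j$ is the $j$-th standard basis vector, let $$\Theta_X^{(j;k)}(z)=\int_X\Theta_p^{(j;k)}(z)\,\mathcal{K}(p,p)^{-k/2}\,\nu_X(p),$$ define $\Theta_Y^{(j;k)}$ in the same way from $Y$ and $\nu_Y$, and put $(F,G)=\int_{\mathcal{F}}F(z)^T\overline{G(z)}\,\mathcal{K}(z,z)^{-k}\,dV(z)$, the integral over $\Gamma\backslash\mathbb{B}^n$. (i) Suppose $\mathrm{dist}(\tilde X\setminus X,Y)>0$. Then for every $l\in\mathbb{N}$ there are constants $C$ and $k_0$, depending only on $l,n,X,Y,\Gamma,\nu_X,\nu_Y$, such that for every $m$, every unitary representation $\rho:\Gamma\to U(m)$ that is trivial on the elements of $\Gamma$ acting as the identity on $\mathbb{B}^n$,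 all $r\ne j$ in $\{1,\dots,m\}$ and all $k\ge k_0$, $$\bigl|(\Theta_X^{(r;k)},\Theta_Y^{(j;k)})\bigr|\le\frac{C}{k^l}.$$ (ii) Suppose $\mathrm{dist}(\tilde X,Y)>0$. Then for every $l\in\mathbb{N}$ there are constants $C$ and $k_0$, depending only on $l,n,X,Y,\Gamma,\nu_X,\nu_Y$, such that for every $m$, every unitary representation $\rho:\Gamma\to U(m)$, all $r,j\in\{1,\dots,m\}$ and all $k\ge k_0$, the same inequality holds. -/

import Mathlib

open MeasureTheory

noncomputable section

namespace BallQuotient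

/-! ### The group `SU(n,1)` and its action on the unit ball -/

/-- The open unit ball `𝔹ⁿ` of `ℂⁿ` (with the Euclidean norm). -/
abbrev Ball (n : ℕ) : Type := {z : EuclideanSpace ℂ (Fin n) // ‖z‖ < 1}

/-- Lebesgue measure `dV_e` on the ball. -/
def lebesgue (n : ℕ) : Measure (Ball n) :=
  (volume : Measure (EuclideanSpace ℂ (Fin n))).comap Subtype.val

/-- The centre of the ball. -/
def origin (n : ℕ) : Ball n := ⟨0, by simp⟩

/-- The matrix `σ = diag(1, …, 1, -1)` of size `n + 1`. -/
def sig (n : ℕ) : Matrix (Fin (n + 1)) (Fin (n + 1)) ℂ :=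
  Matrix.diagonal (Fin.snoc (fun _ : Fin n => (1 : ℂ)) (-1))

/-- `SU(n,1) = {A ∈ SL(n+1,ℂ) | Aᵀ σ Ā = σ}`. -/
def SU (n : ℕ) : Subgroup (Matrix.SpecialLinearGroup (Fin (n + 1)) ℂ) where
  carrier := {A | (A : Matrix (Fin (n + 1)) (Fin (n + 1)) ℂ).transpose * sig n *
    (A : Matrix (Fin (n + 1)) (Fin (n + 1)) ℂ).map (starRingEnd ℂ) = sig n}
  one_mem' := by simp [Matrix.map_one]
  mul_mem' := by
    intro A B hA hB
    simp only [Set.mem_ofPred_eq, Matrix.SpecialLinearGroup.coe_mul, Matrix.transpose_mul,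
      Matrix.map_mul] at *
    calc _ = (B : Matrix (Fin (n + 1)) (Fin (n + 1)) ℂ).transpose *
          ((A : Matrix (Fin (n + 1)) (Fin (n + 1)) ℂ).transpose * sig n *
            (A : Matrix (Fin (n + 1)) (Fin (n + 1)) ℂ).map (starRingEnd ℂ)) *
            (B : Matrix (Fin (n + 1)) (Fin (n + 1)) ℂ).map (starRingEnd ℂ) := by
            simp only [Matrix.mul_assoc]
      _ = _ := by rw [hA, hB]
  inv_mem' := by
    intro A hA
    simp only [Set.mem_ofPred_eq] at *
    have h1 : (A : Matrix (Fin (n + 1)) (Fin (n + 1)) ℂ) *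
        ((A⁻¹ : Matrix.SpecialLinearGroup (Fin (n + 1)) ℂ) : Matrix _ _ ℂ) = 1 := by
      rw [← Matrix.SpecialLinearGroup.coe_mul]; simp
    have h2 := congrArg Matrix.transpose h1
    have h3 := congrArg (fun N : Matrix (Fin (n + 1)) (Fin (n + 1)) ℂ => N.map (starRingEnd ℂ)) h1
    simp only [Matrix.transpose_mul, Matrix.transpose_one] at h2
    simp only [Matrix.map_mul] at h3
    rw [Matrix.map_one _ (map_zero _) (map_one _)] at h3
    conv_lhs => rw [← hA]
    calc _ = (((A⁻¹ : Matrix.SpecialLinearGroup (Fin (n + 1)) ℂ) : Matrix _ _ ℂ).transpose *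
          (A : Matrix (Fin (n + 1)) (Fin (n + 1)) ℂ).transpose) * sig n *
          ((A : Matrix (Fin (n + 1)) (Fin (n + 1)) ℂ).map (starRingEnd ℂ) *
          ((A⁻¹ : Matrix.SpecialLinearGroup (Fin (n + 1)) ℂ) : Matrix _ _ ℂ).map
            (starRingEnd ℂ)) := by simp only [Matrix.mul_assoc]
      _ = _ := by rw [h2, h3]; simp

/-- Homogeneous coordinates `(z₁, …, zₙ, 1)`. -/
def homog {n : ℕ} (z : EuclideanSpace ℂ (Fin n)) : Fin (n + 1) → ℂ :=
  Fin.snoc (fun i => z i) 1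

/-- The vector `A (z₁, …, zₙ, 1)ᵀ`. -/
def num {n : ℕ} (A : SU n) (z : EuclideanSpace ℂ (Fin n)) : Fin (n + 1) → ℂ :=
  ((A : Matrix.SpecialLinearGroup (Fin (n + 1)) ℂ) : Matrix _ _ ℂ).mulVec (homog z)

/-- The denominator `a_{n+1,1} z₁ + … + a_{n+1,n} zₙ + a_{n+1,n+1}`. -/
def den {n : ℕ} (A : SU n) (z : EuclideanSpace ℂ (Fin n)) : ℂ := num A z (Fin.last n)

/-- The fractional-linear transformation defined by `A`. -/
def act {n : ℕ} (A : SU n) (z : EuclideanSpace ℂ (Fin n)) : EuclideanSpace ℂ (Fin n) :=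
  WithLp.toLp 2 fun i => num A z i.castSucc / den A z

theorem dot_sig {n : ℕ} (v : Fin (n + 1) → ℂ) :
    v ⬝ᵥ (sig n).mulVec (fun i => starRingEnd ℂ (v i)) =
      (((∑ i : Fin n, ‖v i.castSucc‖ ^ 2) - ‖v (Fin.last n)‖ ^ 2 : ℝ) : ℂ) := by
  simp [sig, dotProduct, Matrix.mulVec_diagonal, Fin.sum_univ_castSucc, Complex.mul_conj']
  ring

theorem num_form {n : ℕ} (A : SU n) (z : EuclideanSpace ℂ (Fin n)) :
    (∑ i : Fin n, ‖num A z i.castSucc‖ ^ 2) - ‖den A z‖ ^ 2 = ‖z‖ ^ 2 - 1 := by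
  have hA : ((A : Matrix.SpecialLinearGroup (Fin (n + 1)) ℂ) : Matrix _ _ ℂ).transpose * sig n *
    ((A : Matrix.SpecialLinearGroup (Fin (n + 1)) ℂ) : Matrix _ _ ℂ).map (starRingEnd ℂ) =
      sig n := A.2
  have h1 := dot_sig (num A z)
  have h2 := dot_sig (homog z)
  have h3 : (fun i => starRingEnd ℂ (num A z i)) =
      (((A : Matrix.SpecialLinearGroup (Fin (n + 1)) ℂ) : Matrix _ _ ℂ).map
        (starRingEnd ℂ)).mulVec (fun i => starRingEnd ℂ (homog z i)) := by
    funext i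
    simp [num, Matrix.mulVec, dotProduct]
  have h4 : num A z ⬝ᵥ (sig n).mulVec (fun i => starRingEnd ℂ (num A z i)) =
      homog z ⬝ᵥ (sig n).mulVec (fun i => starRingEnd ℂ (homog z i)) := by
    rw [h3]
    conv_rhs => rw [← hA]
    rw [← Matrix.mulVec_mulVec, ← Matrix.mulVec_mulVec, Matrix.dotProduct_mulVec (homog z),
      Matrix.vecMul_transpose]
    rfl
  rw [h1, h2] at h4
  have h5 := Complex.ofReal_injective h4
  rw [den, h5]
  simp [homog, EuclideanSpace.norm_sq_eq]

theorem den_ne_zero {n : ℕ} (A : SU n) {z : EuclideanSpace ℂ (Fin n)} (hz : ‖z‖ < 1) :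
    den A z ≠ 0 := by
  intro h
  have := num_form A z
  rw [h] at this
  have h2 : 0 ≤ ∑ i : Fin n, ‖num A z i.castSucc‖ ^ 2 := by positivity
  have h3 : ‖z‖ ^ 2 < 1 := by nlinarith [norm_nonneg z]
  norm_num at this
  linarith

theorem norm_act_lt {n : ℕ} (A : SU n) {z : EuclideanSpace ℂ (Fin n)} (hz : ‖z‖ < 1) :
    ‖act A z‖ < 1 := by
  have hd : 0 < ‖den A z‖ ^ 2 := by have := norm_pos_iff.2 (den_ne_zero A hz); positivity
  have h3 : ‖z‖ ^ 2 < 1 := by nlinarith [norm_nonneg z]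
  have h1 : ‖act A z‖ ^ 2 = (∑ i : Fin n, ‖num A z i.castSucc‖ ^ 2) / ‖den A z‖ ^ 2 := by
    simp [EuclideanSpace.norm_sq_eq, act, div_pow, Finset.sum_div]
  have h2 : ‖act A z‖ ^ 2 < 1 := by
    rw [h1, div_lt_one hd]
    have := num_form A z
    linarith
  nlinarith [norm_nonneg (act A z)]

theorem homog_act {n : ℕ} (A : SU n) {z : EuclideanSpace ℂ (Fin n)} (hz : ‖z‖ < 1) :
    homog (act A z) = (den A z)⁻¹ • num A z := by
  funext i
  refine Fin.lastCases ?_ (fun i => ?_) i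
  · simp only [homog, Fin.snoc_last, Pi.smul_apply, smul_eq_mul]
    exact (inv_mul_cancel₀ (den_ne_zero A hz)).symm
  · simp [homog, act, div_eq_inv_mul]

theorem num_mul {n : ℕ} (A B : SU n) {z : EuclideanSpace ℂ (Fin n)} (hz : ‖z‖ < 1) :
    num A (act B z) = (den B z)⁻¹ • num (A * B) z := by
  rw [num, homog_act B hz, Matrix.mulVec_smul]
  simp [num]

instance (n : ℕ) : MulAction (SU n) (Ball n) where
  smul A z := ⟨act A z, norm_act_lt A z.2⟩
  one_smul := by
    rintro ⟨z, hz⟩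
    apply Subtype.ext
    change act 1 z = z
    ext i
    simp [act, num, den, homog]
  mul_smul := by
    rintro A B ⟨z, hz⟩
    apply Subtype.ext
    change act (A * B) z = act A (act B z)
    have h := den_ne_zero B hz
    ext i
    simp only [act, den]
    have := num_mul A B hz
    simp only [act, den] at this
    rw [this]
    simp only [Pi.smul_apply, smul_eq_mul]
    rw [mul_div_mul_left]
    exact inv_ne_zero h

/-- The complex Jacobian `J(γ,z) = (a_{n+1,1} z₁ + … + a_{n+1,n+1})^{-(n+1)}`. -/
def jac {n : ℕ} (A : SU n) (z : Ball n) : ℂ := 1 / den A (z : EuclideanSpace ℂ (Fin n)) ^ (n + 1)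

/-! ### Bergman kernel, hyperbolic distance, Dirichlet domain -/

/-- `⟨z,w⟩ = z₁ w̄₁ + … + zₙ w̄ₙ - 1`. -/
def herm {n : ℕ} (z w : Ball n) : ℂ :=
  (∑ i, z.1 i * starRingEnd ℂ (w.1 i)) - 1

/-- The Bergman kernel of the ball with respect to Lebesgue measure. -/
def bergman {n : ℕ} (z w : Ball n) : ℂ :=
  ((n.factorial : ℂ) / (Real.pi : ℂ) ^ n) / (-herm z w) ^ (n + 1)

/-- The Bergman kernel on the diagonal, a positive real number. -/
def bergmanDiag {n : ℕ} (z : Ball n) : ℝ := (bergman z z).re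

/-- The constant `c(𝔹ⁿ,k)`, determined by
`c ∫ 𝒦(z,w)ᵏ 𝒦(w,z)ᵏ 𝒦(w,w)⁻ᵏ dV(w) = 𝒦(z,z)ᵏ` (taken at `z = 0`), with
`dV(w) = 𝒦(w,w) dV_e(w)` and `dV_e` the Lebesgue measure. -/
def repConst (n k : ℕ) : ℂ :=
  bergman (origin n) (origin n) ^ k /
    ∫ w : Ball n, bergman (origin n) w ^ k * bergman w (origin n) ^ k / bergman w w ^ k *
      bergman w w ∂(lebesgue n)

/-- The complex hyperbolic distance: `cosh² (τ(z,w)/2) = ⟨z,w⟩⟨w,z⟩ / (⟨z,z⟩⟨w,w⟩)`. -/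
def tau {n : ℕ} (z w : Ball n) : ℝ :=
  2 * Real.arcosh (Real.sqrt ((herm z w * herm w z) / (herm z z * herm w w)).re)

/-- `dist(A,B) = inf {τ(z,w) | z ∈ A, w ∈ B}`. -/
def setDist {n : ℕ} (A B : Set (Ball n)) : ℝ :=
  sInf {t | ∃ z ∈ A, ∃ w ∈ B, t = tau z w}

/-- The (closed) Dirichlet fundamental domain of `Γ` centred at `p₀`. -/
def dirichlet {n : ℕ} (Γ : Subgroup (SU n)) (p₀ : Ball n) : Set (Ball n) :=
  {z | ∀ γ : Γ, tau z p₀ ≤ tau z (γ • p₀)}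

/-- The ball quotient `M = Γ \ 𝔹ⁿ`, with the quotient topology. -/
abbrev BallQuot {n : ℕ} (Γ : Subgroup (SU n)) : Type := MulAction.orbitRel.Quotient Γ (Ball n)

/-- The projection `π : 𝔹ⁿ → M`. -/
def proj {n : ℕ} (Γ : Subgroup (SU n)) (z : Ball n) : BallQuot Γ := Quotient.mk _ z

/-- `Γ X`, the union of all translates of `X`. -/
def saturation {n : ℕ} (Γ : Subgroup (SU n)) (X : Set (Ball n)) : Set (Ball n) :=
  {w | ∃ γ : Γ, ∃ z ∈ X, w = γ • z}

/-! ### Submanifolds and integration of forms -/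

/-- A set `S` in `ℂⁿ = ℝ²ⁿ` as an embedded smooth submanifold (without boundary) of real
dimension `q`: near each of its points a local diffeomorphism of the ambient space flattens `S`
to a `q`-dimensional real subspace. -/
def IsSubmanifold {n : ℕ} (q : ℕ) (S : Set (EuclideanSpace ℂ (Fin n))) : Prop :=
  ∀ x ∈ S, ∃ (Φ : OpenPartialHomeomorph (EuclideanSpace ℂ (Fin n)) (EuclideanSpace ℂ (Fin n)))
    (W : Submodule ℝ (EuclideanSpace ℂ (Fin n))),
    x ∈ Φ.source ∧
    ContDiffOn ℝ (⊤ : ℕ∞) Φ Φ.source ∧ ContDiffOn ℝ (⊤ : ℕ∞) Φ.symm Φ.target ∧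
    Module.finrank ℝ W = q ∧
    Φ '' (S ∩ Φ.source) = (W : Set (EuclideanSpace ℂ (Fin n))) ∩ Φ.target

/-- A subset of the ball, viewed in `ℂⁿ`. -/
def ambient {n : ℕ} (X : Set (Ball n)) : Set (EuclideanSpace ℂ (Fin n)) := Subtype.val '' X

/-- Submanifolds of `M`. As `π` is a local diffeomorphism onto `M`, a subset of `M` is an embedded
submanifold exactly if its full preimage in the ball is one. -/
def IsSubmanifoldQuot {n : ℕ} (Γ : Subgroup (SU n)) (q : ℕ) (X' : Set (BallQuot Γ)) : Prop :=
  IsSubmanifold q (ambient (proj Γ ⁻¹' X'))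

/-- Fields of alternating real `q`-forms on `ℂⁿ = ℝ²ⁿ`. -/
abbrev FormField (n q : ℕ) : Type :=
  EuclideanSpace ℂ (Fin n) → EuclideanSpace ℂ (Fin n) [⋀^Fin q]→L[ℝ] ℝ

/-- The tangent space `T_x S`. -/
def tangent {n : ℕ} (S : Set (EuclideanSpace ℂ (Fin n))) (x : EuclideanSpace ℂ (Fin n)) :
    Submodule ℝ (EuclideanSpace ℂ (Fin n)) :=
  Submodule.span ℝ (tangentConeAt ℝ S x)

/-- The restriction of the form `ν x` to `T_x S`. -/
def restr {n q : ℕ} (S : Set (EuclideanSpace ℂ (Fin n))) (ν : FormField n q)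
    (x : EuclideanSpace ℂ (Fin n)) : (tangent S x) [⋀^Fin q]→L[ℝ] ℝ :=
  (ν x).compContinuousLinearMap (tangent S x).subtypeL

/-- `o` defines an orientation of the `q`-dimensional submanifold `S`: it is a continuous `q`-form
along `S` whose restriction to `S` vanishes nowhere; a frame is positive if `o` is positive
on it. -/
def IsOrientation {n q : ℕ} (S : Set (EuclideanSpace ℂ (Fin n))) (o : FormField n q) : Prop :=
  ContinuousOn o S ∧ ∀ x ∈ S, restr S o x ≠ 0

/-- `ν` defines a smooth `q`-form on `S`: it is smooth on an open neighbourhood of `S`. (Only its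
restriction to the tangent spaces of `S` matters; every smooth form on an embedded submanifold is
obtained so.) -/
def IsSmoothForm {n q : ℕ} (S : Set (EuclideanSpace ℂ (Fin n))) (ν : FormField n q) : Prop :=
  ∃ U : Set (EuclideanSpace ℂ (Fin n)), IsOpen U ∧ S ⊆ U ∧ ContDiffOn ℝ (⊤ : ℕ∞) ν U

open Classical in
/-- The value of the `q`-form `ν` on a positive orthonormal basis of `T_x S` (`dim S = q`), that is
the density of `ν` with respect to the Euclidean `q`-dimensional volume of `S`. Its absolute value
is the operator norm of `ν|_{T_x S}`, its sign tells whether `ν` and the orientation agree. -/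
def density {n q : ℕ} (S : Set (EuclideanSpace ℂ (Fin n))) (o ν : FormField n q)
    (x : EuclideanSpace ℂ (Fin n)) : ℝ :=
  (if ∃ v, 0 < restr S o x v ∧ 0 < restr S ν x v then 1 else -1) * ‖restr S ν x‖

/-- `∫_X f ν` for a `q`-form `ν` on the `q`-dimensional submanifold `X` oriented by `o`;
`μHE[q]` is the `q`-dimensional Euclidean volume. -/
def formIntegral {n q : ℕ} {V : Type*} [NormedAddCommGroup V] [NormedSpace ℝ V]
    (X : Set (Ball n)) (o ν : FormField n q) (f : Ball n → V) : V :=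
  ∫ x in X, density (ambient X) o ν (x : EuclideanSpace ℂ (Fin n)) • f x ∂μHE[q]

/-- `X` is a submanifold of the fundamental domain, of dimension `q > 0`, of the form
`X = π⁻¹(X') ∩ 𝓕` with `X'` a submanifold of `M` and `π : X → X'` one-to-one (hence a
diffeomorphism), oriented by `o`, and `ν` is a smooth real `q`-form on `X` that is absolutely
integrable and has positive integral. -/
structure IsSubmanifoldWithForm {n : ℕ} (Γ : Subgroup (SU n)) (p₀ : Ball n) (q : ℕ)
    (X' : Set (BallQuot Γ)) (X : Set (Ball n)) (o ν : FormField n q) : Prop where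
  dim_pos : 0 < q
  submanifold_quot : IsSubmanifoldQuot Γ q X'
  submanifold : IsSubmanifold q (ambient X)
  eq_inter : X = proj Γ ⁻¹' X' ∩ dirichlet Γ p₀
  bijOn : Set.BijOn (proj Γ) X X'
  orientation : IsOrientation (ambient X) o
  smooth : IsSmoothForm (ambient X) ν
  integrable : IntegrableOn
    (fun x : Ball n => density (ambient X) o ν (x : EuclideanSpace ℂ (Fin n))) X μHE[q]
  integral_pos : 0 < formIntegral X o ν fun _ => (1 : ℝ)

/-! ### Vector-valued Poincaré series -/

/-- `Θ_p^{(j;k)}(z) = c(𝔹ⁿ,k) ∑_{γ ∈ Γ} ρ(γ⁻¹) 𝒯_p(γ z) J(γ,z)ᵏ`, where the `j`-th component of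
`𝒯_p(z)` is `𝒦(z,p)ᵏ` and all others are zero. -/
def thetaPoint {n m : ℕ} (Γ : Subgroup (SU n)) (ρ : Γ →* Matrix.unitaryGroup (Fin m) ℂ)
    (j : Fin m) (k : ℕ) (p z : Ball n) : Fin m → ℂ :=
  repConst n k • ∑' γ : Γ,
    jac (γ : SU n) z ^ k •
      (ρ γ⁻¹ : Matrix (Fin m) (Fin m) ℂ).mulVec (Pi.single j (bergman (γ • z) p ^ k))

/-- `Θ_X^{(j;k)}(z) = ∫_X Θ_p^{(j;k)}(z) 𝒦(p,p)^{-k/2} ν(p)`. -/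
def thetaSub {n m q : ℕ} (Γ : Subgroup (SU n)) (ρ : Γ →* Matrix.unitaryGroup (Fin m) ℂ)
    (X : Set (Ball n)) (o ν : FormField n q) (j : Fin m) (k : ℕ) (z : Ball n) : Fin m → ℂ :=
  formIntegral X o ν fun p => (bergmanDiag p ^ (-(k : ℝ) / 2)) • thetaPoint Γ ρ j k p z

/-- The inner product `(F,G) = ∫_{Γ \ 𝔹ⁿ} F(z)ᵀ conj(G(z)) 𝒦(z,z)⁻ᵏ dV(z)` of forms of weight `k`,
where `dV(z) = 𝒦(z,z) dV_e(z)`; the integral over the quotient is the integral over the Dirichlet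
fundamental domain. -/
def petersson {n m : ℕ} (Γ : Subgroup (SU n)) (p₀ : Ball n) (k : ℕ) (F G : Ball n → Fin m → ℂ) :
    ℂ :=
  ∫ z in dirichlet Γ p₀,
    (∑ i, F z i * starRingEnd ℂ (G z i)) * ((bergmanDiag z)⁻¹ ^ k * bergmanDiag z : ℝ)
      ∂(lebesgue n)

end BallQuotient

end

noncomputable section

namespace BallQuotient

/-! Write cosh(τ/2) as `coshHalf`; it is `SU(n,1)`-invariant. By `norm_jac_mul_bergman`,
|J(γ,z)𝒦(γz,p)| is √(𝒦(z,z)𝒦(p,p)) times `coshHalf (γz) p` to the power -(n+1), and the weights in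
Θ_X and in the inner product cancel the kernel factors up to one bounded 𝒦(z,z). By unitarity
(`pairing_col`), the pairing of the γ-summand with the γ'-summand carries the scalar ρ(γ'γ⁻¹)_{jr}.

With η = γ'γ⁻¹, either this scalar vanishes or ηp is at a definite distance from q. In case (i), if
ηp ∈ X, injectivity of π on X gives ηp = p, so η acts trivially, ρ(η) = 1, and the entry is zero for
r ≠ j; otherwise ηp ∈ X̃ \ X. In case (ii) the distance bound always applies. The triangle
inequality `coshHalf_le` then forces `coshHalf (γz) p * coshHalf (γ'z) q ≥ κ` for a fixed κ > 1, so
the pairing decays like κ^{-(n+1)k}. The constants c(𝔹ⁿ,k) grow slower than any exponential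
(`norm_repConst_le`), so exponential decay survives (`exists_petersson_decay`), uniformly in m and
ρ.

A fixed number of the powers of 1/cosh is kept back for convergence of the sums over Γ: cosh grows
linearly in the matrix norm of γ on compact sets (`le_coshHalf_smul`), and discreteness makes a
negative power of that norm summable (`exists_separation`, `summable_of_separated`). Compactness of
M keeps the Dirichlet domain away from the sphere, so all bounds are uniform. -/

/-! ### Invariance of the hermitian form and hyperbolic distance -/

theorem herm_eq_inner {n : ℕ} (z w : Ball n) : herm z w = inner ℂ w.1 z.1 - 1 := by
  simp [herm, PiLp.inner_apply]

theorem herm_self {n : ℕ} (z : Ball n) : herm z z = -((1 - ‖z.1‖ ^ 2 : ℝ) : ℂ) := by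
  rw [herm_eq_inner, inner_self_eq_norm_sq_to_K]
  push_cast
  simp

theorem herm_conj {n : ℕ} (z w : Ball n) : starRingEnd ℂ (herm z w) = herm w z := by
  simp [herm_eq_inner]

theorem norm_herm_comm {n : ℕ} (z w : Ball n) : ‖herm z w‖ = ‖herm w z‖ := by
  rw [← herm_conj, RCLike.norm_conj]

theorem one_sub_norm_sq_pos {n : ℕ} (z : Ball n) : 0 < 1 - ‖z.1‖ ^ 2 := by
  have := z.2
  nlinarith [norm_nonneg z.1]

theorem dot_sig_conj {n : ℕ} (v w : Fin (n + 1) → ℂ) :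
    v ⬝ᵥ (sig n).mulVec (fun i => starRingEnd ℂ (w i)) =
      (∑ i : Fin n, v i.castSucc * starRingEnd ℂ (w i.castSucc)) -
        v (Fin.last n) * starRingEnd ℂ (w (Fin.last n)) := by
  simp [sig, dotProduct, Matrix.mulVec_diagonal, Fin.sum_univ_castSucc]
  ring

theorem num_dot_sig_num {n : ℕ} (A : SU n) (z w : EuclideanSpace ℂ (Fin n)) :
    num A z ⬝ᵥ (sig n).mulVec (fun i => starRingEnd ℂ (num A w i)) =
      homog z ⬝ᵥ (sig n).mulVec (fun i => starRingEnd ℂ (homog w i)) := by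
  have hA : ((A : Matrix.SpecialLinearGroup (Fin (n + 1)) ℂ) : Matrix _ _ ℂ).transpose * sig n *
    ((A : Matrix.SpecialLinearGroup (Fin (n + 1)) ℂ) : Matrix _ _ ℂ).map (starRingEnd ℂ) =
      sig n := A.2
  have h3 : (fun i => starRingEnd ℂ (num A w i)) =
      (((A : Matrix.SpecialLinearGroup (Fin (n + 1)) ℂ) : Matrix _ _ ℂ).map
        (starRingEnd ℂ)).mulVec (fun i => starRingEnd ℂ (homog w i)) := by
    funext i
    simp [num, Matrix.mulVec, dotProduct]
  rw [h3]
  conv_rhs => rw [← hA]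
  rw [← Matrix.mulVec_mulVec, ← Matrix.mulVec_mulVec, Matrix.dotProduct_mulVec (homog z),
    Matrix.vecMul_transpose]
  rfl

theorem smul_val {n : ℕ} (A : SU n) (z : Ball n) : (A • z).1 = act A z.1 := rfl

theorem herm_smul_smul {n : ℕ} (A : SU n) (z w : Ball n) :
    herm (A • z) (A • w) * (den A z.1 * starRingEnd ℂ (den A w.1)) = herm z w := by
  have h := num_dot_sig_num A z.1 w.1
  rw [dot_sig_conj, dot_sig_conj] at h
  have hz := den_ne_zero A z.2
  have hw := den_ne_zero A w.2
  have hw' : starRingEnd ℂ (den A w.1) ≠ 0 := by simpa using hw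
  have e1 : herm z w = (∑ i : Fin n, homog z.1 i.castSucc * starRingEnd ℂ (homog w.1 i.castSucc)) -
        homog z.1 (Fin.last n) * starRingEnd ℂ (homog w.1 (Fin.last n)) := by
    simp [herm, homog]
  rw [e1, ← h, herm, sub_mul, Finset.sum_mul, one_mul]
  congr 1
  refine Finset.sum_congr rfl fun i _ => ?_
  simp only [smul_val, act, map_div₀]
  field_simp

theorem one_sub_norm_sq_smul {n : ℕ} (A : SU n) (z : Ball n) :
    (1 - ‖(A • z).1‖ ^ 2) * ‖den A z.1‖ ^ 2 = 1 - ‖z.1‖ ^ 2 := by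
  have h := herm_smul_smul A z z
  rw [herm_self, herm_self, Complex.mul_conj'] at h
  have h2 : (((1 - ‖(A • z).1‖ ^ 2) * ‖den A z.1‖ ^ 2 : ℝ) : ℂ) = ((1 - ‖z.1‖ ^ 2 : ℝ) : ℂ) := by
    rw [← neg_inj, ← h]
    push_cast
    ring
  exact_mod_cast h2

/-- `cosh (τ(z,w)/2)`, see `tau_eq`. -/
def coshHalf {n : ℕ} (z w : Ball n) : ℝ :=
  ‖herm z w‖ / (√(1 - ‖z.1‖ ^ 2) * √(1 - ‖w.1‖ ^ 2))

theorem sqrt_one_sub_norm_sq_smul {n : ℕ} (A : SU n) (z : Ball n) :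
    √(1 - ‖(A • z).1‖ ^ 2) * ‖den A z.1‖ = √(1 - ‖z.1‖ ^ 2) := by
  rw [← one_sub_norm_sq_smul A z, Real.sqrt_mul (one_sub_norm_sq_pos _).le,
    Real.sqrt_sq (norm_nonneg _)]

theorem sqrt_pos_ball {n : ℕ} (z : Ball n) : 0 < √(1 - ‖z.1‖ ^ 2) :=
  Real.sqrt_pos.2 (one_sub_norm_sq_pos z)

theorem coshHalf_smul_smul {n : ℕ} (A : SU n) (z w : Ball n) :
    coshHalf (A • z) (A • w) = coshHalf z w := by
  have hz := norm_pos_iff.2 (den_ne_zero A z.2)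
  have hw := norm_pos_iff.2 (den_ne_zero A w.2)
  have h1 := sqrt_pos_ball (A • z)
  have h2 := sqrt_pos_ball (A • w)
  rw [coshHalf, coshHalf, ← herm_smul_smul A z w, ← sqrt_one_sub_norm_sq_smul A z,
    ← sqrt_one_sub_norm_sq_smul A w, norm_mul, norm_mul, RCLike.norm_conj]
  field_simp

/-- The hermitian form `⟨u,z⟩⟨z,v⟩ - ⟨u,v⟩⟨z,z⟩` is positive semidefinite. -/
theorem herm_mul_sub {n : ℕ} (z u v : Ball n) :
    herm u z * herm z v - herm u v * herm z z =
      ((1 - ‖z.1‖ ^ 2 : ℝ) : ℂ) * inner ℂ (v.1 - z.1) (u.1 - z.1) +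
        inner ℂ z.1 (u.1 - z.1) * inner ℂ (v.1 - z.1) z.1 := by
  have hz : ((‖z.1‖ ^ 2 : ℝ) : ℂ) = inner ℂ z.1 z.1 := by
    rw [inner_self_eq_norm_sq_to_K]; push_cast; rfl
  simp only [herm_eq_inner, inner_sub_left, inner_sub_right, Complex.ofReal_sub, hz,
    Complex.ofReal_one]
  ring

/-- The diagonal case u = v of `herm_mul_sub`. Nonnegativity of the right side is the reversed
Cauchy–Schwarz inequality, that is, cosh ≥ 1. -/
theorem norm_herm_sq_sub {n : ℕ} (z u : Ball n) :
    ‖herm u z‖ ^ 2 - (1 - ‖u.1‖ ^ 2) * (1 - ‖z.1‖ ^ 2) =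
      (1 - ‖z.1‖ ^ 2) * ‖u.1 - z.1‖ ^ 2 + ‖inner ℂ z.1 (u.1 - z.1)‖ ^ 2 := by
  have h := herm_mul_sub z u u
  rw [← herm_conj u z, Complex.mul_conj', herm_self, herm_self,
    ← inner_conj_symm (u.1 - z.1) z.1, Complex.mul_conj', inner_self_eq_norm_sq_to_K] at h
  have h2 : ((‖herm u z‖ ^ 2 - (1 - ‖u.1‖ ^ 2) * (1 - ‖z.1‖ ^ 2) : ℝ) : ℂ) =
      (((1 - ‖z.1‖ ^ 2) * ‖u.1 - z.1‖ ^ 2 + ‖inner ℂ z.1 (u.1 - z.1)‖ ^ 2 : ℝ) : ℂ) := by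
    push_cast at h ⊢
    rw [← sub_eq_zero] at h ⊢
    rw [← h]
    simp only [Complex.coe_algebraMap]
    ring
  exact_mod_cast h2

theorem one_le_coshHalf {n : ℕ} (z w : Ball n) : 1 ≤ coshHalf z w := by
  have hz := one_sub_norm_sq_pos z
  have hw := one_sub_norm_sq_pos w
  rw [coshHalf, one_le_div (mul_pos (sqrt_pos_ball z) (sqrt_pos_ball w)),
    ← Real.sqrt_mul hz.le]
  apply Real.sqrt_le_iff.2 ⟨norm_nonneg _, ?_⟩
  have h := norm_herm_sq_sub w z
  have : 0 ≤ (1 - ‖w.1‖ ^ 2) * ‖z.1 - w.1‖ ^ 2 + ‖inner ℂ w.1 (z.1 - w.1)‖ ^ 2 := by positivity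
  linarith

theorem coshHalf_sq {n : ℕ} (z w : Ball n) :
    coshHalf z w ^ 2 * ((1 - ‖z.1‖ ^ 2) * (1 - ‖w.1‖ ^ 2)) = ‖herm z w‖ ^ 2 := by
  have hz := one_sub_norm_sq_pos z
  have hw := one_sub_norm_sq_pos w
  rw [coshHalf, div_pow, mul_pow, Real.sq_sqrt hz.le, Real.sq_sqrt hw.le,
    div_mul_cancel₀ _ (mul_pos hz hw).ne']

/-- A form of the triangle inequality: `cosh (a + b) ≤ 2 cosh a cosh b - 1`. -/
theorem coshHalf_le {n : ℕ} (z u v : Ball n) :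
    coshHalf u v ≤ 2 * (coshHalf z u * coshHalf z v) - 1 := by
  have hz := one_sub_norm_sq_pos z
  set s := √(1 - ‖z.1‖ ^ 2) with hs
  set a := √(1 - ‖u.1‖ ^ 2) with ha
  set b := √(1 - ‖v.1‖ ^ 2) with hb
  have hs0 : 0 < s := sqrt_pos_ball z
  have ha0 : 0 < a := sqrt_pos_ball u
  have hb0 : 0 < b := sqrt_pos_ball v
  have hs2 : s ^ 2 = 1 - ‖z.1‖ ^ 2 := Real.sq_sqrt hz.le
  have ha2 : a ^ 2 = 1 - ‖u.1‖ ^ 2 := Real.sq_sqrt (one_sub_norm_sq_pos u).le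
  have hb2 : b ^ 2 = 1 - ‖v.1‖ ^ 2 := Real.sq_sqrt (one_sub_norm_sq_pos v).le
  have hu := norm_herm_sq_sub z u
  have hv := norm_herm_sq_sub z v
  rw [← hs2, ← ha2] at hu
  rw [← hs2, ← hb2] at hv
  have h := herm_mul_sub z u v
  set x := ‖u.1 - z.1‖
  set y := ‖v.1 - z.1‖
  set x' := ‖inner ℂ z.1 (u.1 - z.1)‖
  set y' := ‖inner ℂ z.1 (v.1 - z.1)‖ with hy'
  set P := ‖herm u z‖ with hP
  set Q := ‖herm v z‖ with hQ
  have hPa : a * s ≤ P := by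
    apply le_of_sq_le_sq _ (norm_nonneg _)
    nlinarith [mul_nonneg (sq_nonneg s) (sq_nonneg x), sq_nonneg x']
  have hQb : b * s ≤ Q := by
    apply le_of_sq_le_sq _ (norm_nonneg _)
    nlinarith [mul_nonneg (sq_nonneg s) (sq_nonneg y), sq_nonneg y']
  -- After division by a b s², the next two bounds amount to sinh a sinh b ≤ cosh a cosh b - 1:
  -- Cauchy–Schwarz for the semidefinite form, then (PQ - abs²)² - (P² - a²s²)(Q² - b²s²) = (Pbs -
  -- Qas)².
  have hN : ‖herm u z * herm z v - herm u v * herm z z‖ ≤ s ^ 2 * (x * y) + x' * y' := by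
    rw [h]
    refine (norm_add_le _ _).trans ?_
    rw [norm_mul, norm_mul, Complex.norm_real, Real.norm_of_nonneg hz.le, hs2,
      norm_inner_symm (v.1 - z.1) z.1]
    gcongr
    rw [mul_comm x y]
    exact norm_inner_le_norm _ _
  have hN2 : s ^ 2 * (x * y) + x' * y' ≤ P * Q - a * b * s ^ 2 := by
    have h0 : 0 ≤ P * Q - a * b * s ^ 2 := by
      nlinarith [mul_le_mul hPa hQb (by positivity) (norm_nonneg _)]
    apply le_of_sq_le_sq _ h0
    have e1 : (s ^ 2 * (x * y) + x' * y') ^ 2 ≤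
        (s ^ 2 * x ^ 2 + x' ^ 2) * (s ^ 2 * y ^ 2 + y' ^ 2) := by
      nlinarith [sq_nonneg (s * x * y' - s * y * x')]
    rw [← hu, ← hv] at e1
    refine e1.trans ?_
    nlinarith [sq_nonneg (P * b * s - Q * a * s)]
  have hfin : ‖herm u v‖ * s ^ 2 ≤ 2 * (P * Q) - a * b * s ^ 2 := by
    have e1 : ‖herm u v * herm z z‖ = ‖herm u v‖ * s ^ 2 := by
      rw [norm_mul, herm_self, norm_neg, Complex.norm_real, Real.norm_of_nonneg hz.le, hs2]
    have e2 : ‖herm u z * herm z v‖ = P * Q := by rw [norm_mul, norm_herm_comm z v]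
    have e3 := norm_sub_norm_le (herm u v * herm z z) (herm u z * herm z v)
    rw [norm_sub_rev, e1, e2] at e3
    linarith
  have e : 2 * (coshHalf z u * coshHalf z v) - 1 =
      (2 * (P * Q) - a * b * s ^ 2) / (a * b * s ^ 2) := by
    rw [coshHalf, coshHalf, norm_herm_comm z u, norm_herm_comm z v, ← hs, ← ha, ← hb, ← hP, ← hQ]
    field_simp
  rw [e, coshHalf, ← ha, ← hb, le_div_iff₀ (by positivity)]
  calc _ = ‖herm u v‖ * s ^ 2 := by field_simp
    _ ≤ _ := hfin

theorem tau_eq {n : ℕ} (z w : Ball n) : tau z w = 2 * Real.arcosh (coshHalf z w) := by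
  have hz := one_sub_norm_sq_pos z
  have hw := one_sub_norm_sq_pos w
  rw [tau]
  congr 2
  rw [Real.sqrt_eq_iff_mul_self_eq_of_pos (by linarith [one_le_coshHalf z w])]
  rw [← herm_conj z w, Complex.mul_conj', herm_self, herm_self, neg_mul_neg, ← sq]
  have : ((‖herm z w‖ : ℂ) ^ 2 / (((1 - ‖z.1‖ ^ 2 : ℝ) : ℂ) * ((1 - ‖w.1‖ ^ 2 : ℝ) : ℂ))) =
    ((‖herm z w‖ ^ 2 / ((1 - ‖z.1‖ ^ 2) * (1 - ‖w.1‖ ^ 2)) : ℝ) : ℂ) := by push_cast; rfl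
  rw [this, Complex.ofReal_re, ← coshHalf_sq, mul_div_cancel_right₀ _ (mul_pos hz hw).ne']

theorem tau_nonneg {n : ℕ} (z w : Ball n) : 0 ≤ tau z w := by
  rw [tau_eq]
  have := Real.arcosh_nonneg (one_le_coshHalf z w)
  linarith

theorem cosh_half_le_coshHalf {n : ℕ} {z w : Ball n} {δ : ℝ} (hδ : 0 ≤ δ) (h : δ ≤ tau z w) :
    Real.cosh (δ / 2) ≤ coshHalf z w := by
  rw [← Real.cosh_arcosh (one_le_coshHalf z w), Real.cosh_le_cosh, abs_of_nonneg (by linarith),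
    abs_of_nonneg (Real.arcosh_nonneg (one_le_coshHalf z w))]
  rw [tau_eq] at h
  linarith

theorem coshHalf_le_of_tau_le {n : ℕ} {z w z' w' : Ball n} (h : tau z w ≤ tau z' w') :
    coshHalf z w ≤ coshHalf z' w' := by
  rw [← Real.cosh_arcosh (one_le_coshHalf z w), ← Real.cosh_arcosh (one_le_coshHalf z' w'),
    Real.cosh_le_cosh, abs_of_nonneg (Real.arcosh_nonneg (one_le_coshHalf z w)),
    abs_of_nonneg (Real.arcosh_nonneg (one_le_coshHalf z' w'))]
  rw [tau_eq, tau_eq] at h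
  linarith

theorem setDist_le {n : ℕ} {A B : Set (Ball n)} {z w : Ball n} (hz : z ∈ A) (hw : w ∈ B) :
    setDist A B ≤ tau z w := by
  refine csInf_le ⟨0, ?_⟩ ⟨z, hz, w, hw, rfl⟩
  rintro t ⟨z, -, w, -, rfl⟩
  exact tau_nonneg z w

/-! ### Matrix entries -/

/-- The entries of a matrix in `SU(n,1)`. -/
def entries {n : ℕ} (A : SU n) : Fin (n + 1) → Fin (n + 1) → ℂ :=
  fun i j => ((A : Matrix.SpecialLinearGroup (Fin (n + 1)) ℂ) : Matrix _ _ ℂ) i j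

theorem entries_col {n : ℕ} (A : SU n) (i j : Fin (n + 1)) :
    (∑ k : Fin n, entries A k.castSucc i * starRingEnd ℂ (entries A k.castSucc j)) -
      entries A (Fin.last n) i * starRingEnd ℂ (entries A (Fin.last n) j) = sig n i j := by
  have hA : ((A : Matrix.SpecialLinearGroup (Fin (n + 1)) ℂ) : Matrix _ _ ℂ).transpose * sig n *
    ((A : Matrix.SpecialLinearGroup (Fin (n + 1)) ℂ) : Matrix _ _ ℂ).map (starRingEnd ℂ) =
      sig n := A.2
  conv_rhs => rw [← hA]
  rw [Matrix.mul_assoc, Matrix.mul_apply]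
  simp only [sig, Matrix.diagonal_mul, Fin.sum_univ_castSucc, entries]
  simp
  ring

/-- The defining relation gives Aᵀσ = σ times the conjugate of A⁻¹, and σ only changes signs. -/
theorem norm_entries_inv {n : ℕ} (A : SU n) (i j : Fin (n + 1)) :
    ‖entries A⁻¹ i j‖ = ‖entries A j i‖ := by
  have hA : ((A : Matrix.SpecialLinearGroup (Fin (n + 1)) ℂ) : Matrix _ _ ℂ).transpose * sig n *
    ((A : Matrix.SpecialLinearGroup (Fin (n + 1)) ℂ) : Matrix _ _ ℂ).map (starRingEnd ℂ) =
      sig n := A.2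
  have hε : ∀ i : Fin (n + 1),
      ‖Fin.snoc (α := fun _ => ℂ) (fun _ : Fin n => (1 : ℂ)) (-1) i‖ = 1 := by
    intro i
    refine Fin.lastCases ?_ (fun i => ?_) i <;> simp
  have h1 : ((A : Matrix.SpecialLinearGroup (Fin (n + 1)) ℂ) :
      Matrix (Fin (n + 1)) (Fin (n + 1)) ℂ) *
      (((A⁻¹ : SU n) : Matrix.SpecialLinearGroup (Fin (n + 1)) ℂ) :
        Matrix (Fin (n + 1)) (Fin (n + 1)) ℂ) = 1 := by
    rw [← Matrix.SpecialLinearGroup.coe_mul, ← Subgroup.coe_mul]; simp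
  have h3 := congrArg (fun N : Matrix (Fin (n + 1)) (Fin (n + 1)) ℂ => N.map (starRingEnd ℂ)) h1
  simp only [Matrix.map_mul] at h3
  rw [Matrix.map_one _ (map_zero _) (map_one _)] at h3
  have h4 := congrArg (· * (((A⁻¹ : SU n) : Matrix.SpecialLinearGroup (Fin (n + 1)) ℂ) :
    Matrix (Fin (n + 1)) (Fin (n + 1)) ℂ).map (starRingEnd ℂ)) hA
  simp only [Matrix.mul_assoc, h3, Matrix.mul_one] at h4
  have h5 := congrArg (fun N : Matrix (Fin (n + 1)) (Fin (n + 1)) ℂ => ‖N i j‖) h4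
  simp only [sig, Matrix.mul_diagonal, Matrix.diagonal_mul, norm_mul, hε] at h5
  simpa [entries] using h5.symm

theorem entries_col_norm {n : ℕ} (A : SU n) (j : Fin (n + 1)) :
    ((∑ k : Fin n, ‖entries A k.castSucc j‖ ^ 2) - ‖entries A (Fin.last n) j‖ ^ 2 : ℝ) =
      (sig n j j).re := by
  have h := congrArg Complex.re (entries_col A j j)
  simp only [Complex.mul_conj'] at h
  rw [← h]
  norm_cast

theorem entries_row_last {n : ℕ} (A : SU n) :
    (∑ k : Fin n, ‖entries A (Fin.last n) k.castSucc‖ ^ 2) =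
      ‖entries A (Fin.last n) (Fin.last n)‖ ^ 2 - 1 := by
  have h := entries_col_norm A⁻¹ (Fin.last n)
  simp only [norm_entries_inv] at h
  simp only [sig, Matrix.diagonal_apply_eq, Fin.snoc_last, Complex.neg_re, Complex.one_re] at h
  linarith

theorem one_le_norm_last {n : ℕ} (A : SU n) :
    1 ≤ ‖entries A (Fin.last n) (Fin.last n)‖ := by
  have h := entries_row_last A
  have h2 : 0 ≤ ∑ k : Fin n, ‖entries A (Fin.last n) k.castSucc‖ ^ 2 := by positivity
  nlinarith [norm_nonneg (entries A (Fin.last n) (Fin.last n))]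

/-- The corner entry dominates the last row (`entries_row_last`), and the column relations then
bound each remaining entry by t² + 1 ≤ 4t² in square. -/
theorem norm_entries_le {n : ℕ} (A : SU n) :
    ‖entries A‖ ≤ 2 * ‖entries A (Fin.last n) (Fin.last n)‖ := by
  set t := ‖entries A (Fin.last n) (Fin.last n)‖ with ht
  have h1 : 1 ≤ t := one_le_norm_last A
  have hlast : ∀ j, ‖entries A (Fin.last n) j‖ ^ 2 ≤ t ^ 2 := by
    intro j
    refine Fin.lastCases le_rfl (fun k => ?_) j
    have h := entries_row_last A
    have h2 := Finset.single_le_sum (f := fun k : Fin n => ‖entries A (Fin.last n) k.castSucc‖ ^ 2)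
      (fun _ _ => by positivity) (Finset.mem_univ k)
    rw [← ht] at h
    linarith
  have hsig : ∀ j, (sig n j j).re ≤ 1 := by
    intro j
    refine Fin.lastCases ?_ (fun i => ?_) j <;> simp [sig]
  refine (pi_norm_le_iff_of_nonneg (by linarith)).2 fun i =>
    (pi_norm_le_iff_of_nonneg (by linarith)).2 fun j => ?_
  apply le_of_sq_le_sq _ (by linarith)
  refine Fin.lastCases ?_ (fun k => ?_) i
  · nlinarith [hlast j]
  · have h := entries_col_norm A j
    have h2 := Finset.single_le_sum (f := fun k : Fin n => ‖entries A k.castSucc j‖ ^ 2)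
      (fun _ _ => by positivity) (Finset.mem_univ k)
    nlinarith [hlast j, hsig j]

theorem den_eq {n : ℕ} (A : SU n) (z : EuclideanSpace ℂ (Fin n)) :
    den A z = (∑ k : Fin n, entries A (Fin.last n) k.castSucc * z k) +
      entries A (Fin.last n) (Fin.last n) := by
  simp [den, num, homog, Matrix.mulVec, dotProduct, Fin.sum_univ_castSucc, entries]

theorem le_norm_den {n : ℕ} (A : SU n) (z : Ball n) :
    ‖entries A (Fin.last n) (Fin.last n)‖ * (1 - ‖z.1‖) ≤ ‖den A z.1‖ := by
  set t := ‖entries A (Fin.last n) (Fin.last n)‖ with ht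
  have h1 : ‖∑ k : Fin n, entries A (Fin.last n) k.castSucc * z.1 k‖ ≤ t * ‖z.1‖ := by
    refine (norm_sum_le _ _).trans ?_
    simp only [norm_mul]
    refine (Real.sum_mul_le_sqrt_mul_sqrt _ _ _).trans ?_
    rw [← EuclideanSpace.norm_eq z.1, entries_row_last]
    gcongr
    rw [Real.sqrt_le_left (norm_nonneg _)]
    linarith
  have h2 := norm_sub_norm_le (entries A (Fin.last n) (Fin.last n))
    (-∑ k : Fin n, entries A (Fin.last n) k.castSucc * z.1 k)
  rw [norm_neg, sub_neg_eq_add, add_comm (entries A _ _), ← den_eq, ← ht] at h2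
  linarith

theorem le_norm_herm {n : ℕ} (z w : Ball n) : 1 - ‖w.1‖ ≤ ‖herm z w‖ := by
  rw [herm_eq_inner, norm_sub_rev]
  have h := norm_sub_norm_le (1 : ℂ) (inner ℂ w.1 z.1)
  have h2 := norm_inner_le_norm (𝕜 := ℂ) w.1 z.1
  rw [norm_one] at h
  nlinarith [norm_nonneg w.1, z.2, norm_nonneg z.1]

/-- Quantitative properness of the action: the denominator at z is at least (1 - R) times the corner
entry t, and 1 + ‖A‖ ≤ 3t. -/
theorem le_coshHalf_smul {n : ℕ} (A : SU n) {z p : Ball n} {R : ℝ} (hz : ‖z.1‖ ≤ R)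
    (hp : ‖p.1‖ ≤ R) (hR : R < 1) :
    (1 - R) ^ 2 / 3 * (1 + ‖entries A‖) ≤ coshHalf (A • z) p := by
  have h1 := sqrt_one_sub_norm_sq_smul A z
  have hd := norm_pos_iff.2 (den_ne_zero A z.2)
  have hs := sqrt_pos_ball (A • z)
  have hp0 := sqrt_pos_ball p
  have hz1 : √(1 - ‖z.1‖ ^ 2) ≤ 1 := by
    rw [Real.sqrt_le_left zero_le_one]; nlinarith [norm_nonneg z.1]
  have hp1 : √(1 - ‖p.1‖ ^ 2) ≤ 1 := by
    rw [Real.sqrt_le_left zero_le_one]; nlinarith [norm_nonneg p.1]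
  have e : coshHalf (A • z) p =
      ‖herm (A • z) p‖ * ‖den A z.1‖ / (√(1 - ‖z.1‖ ^ 2) * √(1 - ‖p.1‖ ^ 2)) := by
    rw [coshHalf, ← h1]
    field_simp
  have ht := one_le_norm_last A
  have h2 := norm_entries_le A
  have h3 := le_norm_den A z
  have h4 := le_norm_herm (A • z) p
  set t := ‖entries A (Fin.last n) (Fin.last n)‖
  have h5 : (1 - R) * (t * (1 - R)) ≤ ‖herm (A • z) p‖ * ‖den A z.1‖ := by
    have : t * (1 - R) ≤ t * (1 - ‖z.1‖) := by gcongr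
    refine mul_le_mul (by linarith) (by linarith) ?_ (norm_nonneg _)
    exact mul_nonneg (by linarith) (by linarith)
  rw [e]
  calc _ ≤ (1 - R) * (t * (1 - R)) := by
        have : 0 ≤ (1 - R) ^ 2 := sq_nonneg _
        nlinarith
    _ ≤ ‖herm (A • z) p‖ * ‖den A z.1‖ := h5
    _ ≤ _ := by
        apply le_div_self (by positivity) (mul_pos (sqrt_pos_ball z) hp0)
        exact mul_le_one₀ hz1 hp0.le hp1

theorem entries_mul {n : ℕ} (A B : SU n) (i j : Fin (n + 1)) :
    entries (A * B) i j = ∑ k, entries A i k * entries B k j := by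
  simp [entries, Matrix.mul_apply]

theorem norm_entries_inv_mul_sub_one {n : ℕ} (A B : SU n) :
    ‖entries (A⁻¹ * B) - entries (1 : SU n)‖ ≤
      (n + 1) * (‖entries A‖ * ‖entries A - entries B‖) := by
  have h0 : 0 ≤ (n + 1) * (‖entries A‖ * ‖entries A - entries B‖) := by positivity
  refine (pi_norm_le_iff_of_nonneg h0).2 fun i => (pi_norm_le_iff_of_nonneg h0).2 fun j => ?_
  have e : (entries (A⁻¹ * B) - entries (1 : SU n)) i j =
      ∑ k, entries A⁻¹ i k * (entries B - entries A) k j := by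
    have h1 : entries (1 : SU n) i j = ∑ k, entries A⁻¹ i k * entries A k j := by
      rw [← entries_mul, inv_mul_cancel]
    simp only [Pi.sub_apply, mul_sub, Finset.sum_sub_distrib]
    rw [← h1, entries_mul]
  have hent : ∀ (f : Fin (n + 1) → Fin (n + 1) → ℂ) (i j : Fin (n + 1)), ‖f i j‖ ≤ ‖f‖ :=
    fun f i j => (norm_le_pi_norm (f i) j).trans (norm_le_pi_norm f i)
  rw [e]
  refine (norm_sum_le_of_le (n := fun _ => ‖entries A‖ * ‖entries A - entries B‖)
    Finset.univ fun k _ => ?_).trans ?_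
  · rw [norm_mul, norm_entries_inv, norm_sub_rev (entries A)]
    exact mul_le_mul (hent _ _ _) (hent _ _ _) (norm_nonneg _) (norm_nonneg _)
  · simp

/-- Discreteness isolates the identity; applying this to γ⁻¹γ' costs a factor comparable to ‖γ⁻¹‖ =
‖γ‖, which explains the weight. The bound ε ≤ 1 keeps the packing radii below at most 1. -/
theorem exists_separation {n : ℕ} (Γ : Subgroup (SU n)) [DiscreteTopology Γ] :
    ∃ ε : ℝ, 0 < ε ∧ ε ≤ 1 ∧ ∀ γ γ' : Γ, γ ≠ γ' →
      ε ≤ ‖entries (γ : SU n) - entries (γ' : SU n)‖ * (1 + ‖entries (γ : SU n)‖) := by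
  have hcont : Topology.IsInducing fun γ : Γ => entries (γ : SU n) :=
    Topology.IsInducing.subtypeVal.comp
      (Topology.IsInducing.subtypeVal.comp Topology.IsInducing.subtypeVal)
  have h1 : ({1} : Set Γ) ∈ nhds (1 : Γ) := (isOpen_discrete _).mem_nhds rfl
  rw [hcont.nhds_eq_comap, (Metric.nhds_basis_ball.comap _).mem_iff] at h1
  obtain ⟨ε, hε, hsub⟩ := h1
  have key : ∀ γ : Γ, γ ≠ 1 → ε ≤ ‖entries (γ : SU n) - entries (1 : SU n)‖ := by
    intro γ hγ
    by_contra! h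
    apply hγ
    have : γ ∈ (fun γ : Γ => entries (γ : SU n)) ⁻¹'
        Metric.ball (entries ((1 : Γ) : SU n)) ε := by
      simpa [dist_eq_norm] using h
    exact hsub this
  refine ⟨min 1 (ε / (n + 1)), by positivity, min_le_left _ _, fun γ γ' hne => ?_⟩
  have h2 := key (γ⁻¹ * γ') (by rwa [ne_eq, inv_mul_eq_one])
  have h3 := h2.trans (norm_entries_inv_mul_sub_one (γ : SU n) (γ' : SU n))
  refine (min_le_right _ _).trans ?_
  rw [div_le_iff₀ (by positivity)]
  refine h3.trans ?_
  nlinarith [norm_nonneg (entries (γ : SU n) - entries (γ' : SU n)),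
    norm_nonneg (entries (γ : SU n)),
    mul_nonneg (Nat.cast_nonneg (α := ℝ) n)
      (norm_nonneg (entries (γ : SU n) - entries (γ' : SU n)))]

end BallQuotient

/-! ### Separated families -/

-- A packing argument: the balls of radius ε/(2(1+‖f i‖)) are disjoint, and (1+‖x‖)^{-(d+1)} is
-- integrable. The volume of the i-th ball contributes d powers of 1/(1+‖f i‖) and the integrand d +
-- 1, hence the exponent 2d + 1.
open Module in
theorem summable_of_separated {E ι : Type*} [NormedAddCommGroup E] [NormedSpace ℝ E]
    [FiniteDimensional ℝ E] (f : ι → E) {ε : ℝ} (hε : 0 < ε) (hε1 : ε ≤ 1)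
    (hsep : ∀ i j, i ≠ j → ε ≤ ‖f i - f j‖ * (1 + ‖f i‖)) :
    Summable fun i => (1 / (1 + ‖f i‖)) ^ (2 * finrank ℝ E + 1) := by
  classical
  borelize E
  have := FiniteDimensional.proper_real E
  set μ : Measure E := Measure.addHaar
  set d := finrank ℝ E with hd
  have hint : Integrable (fun x : E => (1 + ‖x‖) ^ (-((d : ℝ) + 1))) μ :=
    integrable_one_add_norm (by simp [hd])
  set r : ι → ℝ := fun i => ε / (2 * (1 + ‖f i‖)) with hr
  have hr0 : ∀ i, 0 < r i := fun i => by simp only [hr]; positivity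
  have hr1 : ∀ i, r i ≤ 1 := fun i => by
    simp only [hr]
    rw [div_le_one (by positivity)]
    linarith [norm_nonneg (f i)]
  have hdisj : Pairwise (Function.onFun Disjoint fun i => Metric.ball (f i) (r i)) := by
    -- The centre of larger norm has the smaller radius, so separation as seen from the other centre
    -- suffices.
    have key : ∀ i j, i ≠ j → ‖f i‖ ≤ ‖f j‖ → r i + r j ≤ ‖f i - f j‖ := by
      intro i j hij hle
      have h1 : r j ≤ r i := by simp only [hr]; gcongr
      have h2 : r i + r i ≤ ‖f i - f j‖ := by
        have : r i + r i = ε / (1 + ‖f i‖) := by simp only [hr]; field_simp; ring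
        rw [this, div_le_iff₀ (by positivity)]
        exact hsep i j hij
      linarith
    intro i j hij
    refine Metric.ball_disjoint_ball ?_
    rw [dist_eq_norm]
    rcases le_total ‖f i‖ ‖f j‖ with h | h
    · exact key i j hij h
    · rw [add_comm, norm_sub_rev]; exact key j i hij.symm h
  set c : ℝ := (ε / 2) ^ d * μ.real (Metric.ball 0 1) * 2⁻¹ ^ (d + 1) with hc
  have hball : 0 < μ.real (Metric.ball (0 : E) 1) :=
    ENNReal.toReal_pos (Metric.measure_ball_pos μ _ one_pos).ne' measure_ball_lt_top.ne
  have hc0 : 0 < c := by positivity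
  have hlow : ∀ i, c * (1 / (1 + ‖f i‖)) ^ (2 * d + 1) ≤
      ∫ x in Metric.ball (f i) (r i), (1 + ‖x‖) ^ (-((d : ℝ) + 1)) ∂μ := by
    intro i
    have h1 : ∀ x ∈ Metric.ball (f i) (r i),
        (2⁻¹ * (1 / (1 + ‖f i‖))) ^ (d + 1) ≤ (1 + ‖x‖) ^ (-((d : ℝ) + 1)) := by
      intro x hx
      rw [Metric.mem_ball, dist_eq_norm] at hx
      have h2 : ‖x‖ ≤ ‖f i‖ + 1 := by
        have := norm_sub_norm_le x (f i)
        linarith [hr1 i]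
      have h3 : (1 + ‖x‖) ^ (-((d : ℝ) + 1)) = ((1 + ‖x‖)⁻¹) ^ (d + 1) := by
        rw [Real.rpow_neg (by positivity), inv_pow]
        congr 1
        exact_mod_cast Real.rpow_natCast (1 + ‖x‖) (d + 1)
      rw [h3]
      gcongr
      rw [one_div, ← mul_inv]
      gcongr
      linarith [norm_nonneg (f i)]
    have h4 := setIntegral_ge_of_const_le_real measurableSet_ball measure_ball_lt_top.ne h1
      hint.integrableOn
    refine le_trans (le_of_eq ?_) h4
    rw [Measure.real, Measure.addHaar_ball_of_pos μ _ (hr0 i), ENNReal.toReal_mul,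
      ENNReal.toReal_ofReal (pow_nonneg (hr0 i).le _), ← Measure.real, hc, hr, ← hd]
    have e : ε / (2 * (1 + ‖f i‖)) = ε / 2 * (1 / (1 + ‖f i‖)) := by field_simp
    simp only [e]
    ring
  refine (summable_mul_left_iff hc0.ne').1 ?_
  refine summable_of_sum_le (c := ∫ x, (1 + ‖x‖) ^ (-((d : ℝ) + 1)) ∂μ)
    (fun i => by simp only [Pi.zero_apply]; positivity) fun s => ?_
  calc _ ≤ ∑ i ∈ s, ∫ x in Metric.ball (f i) (r i), (1 + ‖x‖) ^ (-((d : ℝ) + 1)) ∂μ :=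
        Finset.sum_le_sum fun i _ => hlow i
    _ = ∫ x in ⋃ i ∈ s, Metric.ball (f i) (r i), (1 + ‖x‖) ^ (-((d : ℝ) + 1)) ∂μ := by
        rw [integral_biUnion_finset s (fun i _ => measurableSet_ball)
          (fun i _ j _ hij => hdisj hij) (fun i _ => hint.integrableOn)]
    _ ≤ _ := setIntegral_le_integral hint (Filter.Eventually.of_forall fun x => by positivity)

/-! ### Bounds for bilinear expressions -/

/-- The integrals are pulled through B one at a time, so neither a product measure nor σ-finiteness
nor joint measurability enters. -/
theorem norm_bilin_integral_le {α β E F G : Type*} [MeasurableSpace α] [MeasurableSpace β]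
    {μ : Measure α} {ν : Measure β} [NormedAddCommGroup E] [NormedSpace ℝ E] [CompleteSpace E]
    [NormedAddCommGroup F] [NormedSpace ℝ F] [CompleteSpace F] [NormedAddCommGroup G]
    [NormedSpace ℝ G] [CompleteSpace G]
    (B : E →L[ℝ] F →L[ℝ] G) {f : α → E} {g : β → F} {u : α → ℝ} {v : β → ℝ} {M : ℝ}
    (hM : 0 ≤ M) (hu0 : 0 ≤ u) (hv0 : 0 ≤ v)
    (hu : Integrable u μ) (hv : Integrable v ν)
    (h : ∀ᵐ a ∂μ, ∀ᵐ b ∂ν, ‖B (f a) (g b)‖ ≤ M * u a * v b) :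
    ‖B (∫ a, f a ∂μ) (∫ b, g b ∂ν)‖ ≤ M * (∫ a, u a ∂μ) * ∫ b, v b ∂ν := by
  have hU : 0 ≤ ∫ a, u a ∂μ := integral_nonneg hu0
  have hV : 0 ≤ ∫ b, v b ∂ν := integral_nonneg hv0
  -- A non-integrable function has integral 0 by convention, and the bound is then trivial;
  -- integrability of f and g need not be proved in applications.
  by_cases hf : Integrable f μ
  swap
  · rw [integral_undef hf]; simp only [map_zero, _root_.zero_apply, norm_zero]
    positivity
  by_cases hg : Integrable g ν
  swap
  · rw [integral_undef hg]; simp only [map_zero, norm_zero]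
    positivity
  have h1 : ∀ᵐ a ∂μ, ‖B.flip (∫ b, g b ∂ν) (f a)‖ ≤ M * (∫ b, v b ∂ν) * u a := by
    filter_upwards [h] with a ha
    rw [ContinuousLinearMap.flip_apply, ← ContinuousLinearMap.integral_comp_comm _ hg]
    refine (norm_integral_le_of_norm_le (hv.const_mul (M * u a)) ha).trans (le_of_eq ?_)
    rw [integral_const_mul]
    ring
  have h2 : B (∫ a, f a ∂μ) (∫ b, g b ∂ν) = ∫ a, B.flip (∫ b, g b ∂ν) (f a) ∂μ := by
    rw [ContinuousLinearMap.integral_comp_comm _ hf, ContinuousLinearMap.flip_apply]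
  rw [h2]
  refine (norm_integral_le_of_norm_le (hu.const_mul _) h1).trans (le_of_eq ?_)
  rw [integral_const_mul]
  ring

theorem norm_bilin_tsum_le {α β E F G : Type*}
    [NormedAddCommGroup E] [NormedSpace ℝ E]
    [NormedAddCommGroup F] [NormedSpace ℝ F] [NormedAddCommGroup G]
    [NormedSpace ℝ G]
    (B : E →L[ℝ] F →L[ℝ] G) {f : α → E} {g : β → F} {u : α → ℝ} {v : β → ℝ} {M : ℝ}
    (hf : Summable f) (hg : Summable g) (hu : Summable u) (hv : Summable v)
    (h : ∀ a b, ‖B (f a) (g b)‖ ≤ M * u a * v b) :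
    ‖B (∑' a, f a) (∑' b, g b)‖ ≤ M * (∑' a, u a) * ∑' b, v b := by
  have h1 : ∀ a, ‖B.flip (∑' b, g b) (f a)‖ ≤ M * (∑' b, v b) * u a := by
    intro a
    rw [ContinuousLinearMap.flip_apply, ContinuousLinearMap.map_tsum _ hg]
    refine (tsum_of_norm_bounded (hv.hasSum.mul_left (M * u a)) (h a)).trans (le_of_eq ?_)
    ring
  have h2 : B (∑' a, f a) (∑' b, g b) = ∑' a, B.flip (∑' b, g b) (f a) := by
    rw [← ContinuousLinearMap.map_tsum _ hf, ContinuousLinearMap.flip_apply]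
  rw [h2]
  refine (tsum_of_norm_bounded (hu.hasSum.mul_left _) h1).trans (le_of_eq ?_)
  ring

/-! ### Measurability of submanifolds and summability over the group -/

theorem IsLocallyClosed.measurableSet_of_borel {α : Type*} [TopologicalSpace α]
    [MeasurableSpace α] [OpensMeasurableSpace α] {s : Set α} (hs : IsLocallyClosed s) :
    MeasurableSet s := by
  obtain ⟨U, Z, hU, hZ, rfl⟩ := hs
  exact hU.measurableSet.inter hZ.measurableSet

namespace BallQuotient

/-- In a flattening chart S is the trace of a finite-dimensional, hence closed, subspace. -/
theorem IsSubmanifold.isLocallyClosed {n q : ℕ} {S : Set (EuclideanSpace ℂ (Fin n))}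
    (hS : IsSubmanifold q S) : IsLocallyClosed S := by
  refine ((isLocallyClosed_tfae S).out 0 3).2 fun x hx => ?_
  obtain ⟨Φ, W, hxΦ, -, -, -, hΦ⟩ := hS x hx
  refine ⟨Φ.source, hxΦ, Φ.open_source, fun y ⟨hy, hyS⟩ => ?_⟩
  have h1 : y ∈ closure (Φ.source ∩ S) := Φ.open_source.inter_closure ⟨hy, hyS⟩
  have h2 : Φ y ∈ closure (Φ '' (Φ.source ∩ S)) :=
    mem_closure_image (Φ.continuousAt hy) h1
  rw [Set.inter_comm, hΦ] at h2
  have h3 : Φ y ∈ (W : Set (EuclideanSpace ℂ (Fin n))) :=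
    closure_minimal Set.inter_subset_left W.closed_of_finiteDimensional h2
  have h4 : Φ y ∈ Φ '' (S ∩ Φ.source) := by rw [hΦ]; exact ⟨h3, Φ.map_source hy⟩
  obtain ⟨s, ⟨hs, hs'⟩, hsy⟩ := h4
  rw [← Φ.injOn hs' hy hsy]
  exact hs

theorem IsSubmanifold.measurableSet {n q : ℕ} {X : Set (Ball n)}
    (hX : IsSubmanifold q (ambient X)) : MeasurableSet X := by
  have h := hX.isLocallyClosed.measurableSet_of_borel
  have e : X = Subtype.val ⁻¹' ambient X := by
    rw [ambient, Set.preimage_image_eq _ Subtype.val_injective]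
  rw [e]
  exact measurable_subtype_coe h

theorem summable_entries {n : ℕ} (Γ : Subgroup (SU n)) [DiscreteTopology Γ] :
    ∃ N : ℕ, Summable fun γ : Γ => (1 / (1 + ‖entries (γ : SU n)‖)) ^ N := by
  obtain ⟨ε, h0, h1, h⟩ := exists_separation Γ
  exact ⟨_, summable_of_separated _ h0 h1 h⟩

/-! ### The Dirichlet domain is relatively compact -/

theorem continuous_num {n : ℕ} (A : SU n) (i : Fin (n + 1)) :
    Continuous fun z : EuclideanSpace ℂ (Fin n) => num A z i := by
  simp only [num, Matrix.mulVec, dotProduct, Fin.sum_univ_castSucc, homog, Fin.snoc_castSucc,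
    Fin.snoc_last]
  fun_prop

theorem continuous_smul_ball {n : ℕ} (A : SU n) : Continuous fun z : Ball n => A • z := by
  refine Continuous.subtype_mk (f := fun z : Ball n => act A z.1) ?_ _
  refine (PiLp.continuous_toLp 2 _).comp (continuous_pi fun i => ?_)
  exact ((continuous_num A _).comp continuous_subtype_val).div
    ((continuous_num A _).comp continuous_subtype_val) fun z => den_ne_zero A z.2

instance {n : ℕ} (Γ : Subgroup (SU n)) : ContinuousConstSMul Γ (Ball n) :=
  ⟨fun γ => continuous_smul_ball (γ : SU n)⟩

/-- The images of the balls of radius 1 - 1/(m+1) are an increasing open cover of the compact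
quotient, so one of them is everything. -/
theorem exists_orbit_meets_ball {n : ℕ} (Γ : Subgroup (SU n)) [CompactSpace (BallQuot Γ)] :
    ∃ R : ℝ, R < 1 ∧ ∀ z : Ball n, ∃ γ : Γ, ‖(γ • z).1‖ < R := by
  have hopen : IsOpenMap (proj Γ) := isOpenMap_quotient_mk'_mul
  have hmono : Monotone fun m : ℕ => proj Γ '' {z : Ball n | ‖z.1‖ < 1 - 1 / ((m : ℝ) + 1)} := by
    intro a b hab
    refine Set.image_mono fun z hz => ?_
    simp only [Set.mem_ofPred_eq] at hz ⊢
    refine hz.trans_le ?_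
    gcongr
  obtain ⟨m, hm⟩ := isCompact_univ.elim_directed_cover
    (fun m : ℕ => proj Γ '' {z : Ball n | ‖z.1‖ < 1 - 1 / ((m : ℝ) + 1)})
    (fun m => hopen _ (isOpen_lt (by fun_prop) continuous_const)) (by
      intro x _
      induction x using Quotient.inductionOn with | _ z => ?_
      obtain ⟨m, hm⟩ := exists_nat_one_div_lt (sub_pos.2 z.2)
      exact Set.mem_iUnion.2 ⟨m, z, by simp only [Set.mem_ofPred_eq]; linarith, rfl⟩)
    hmono.directed_le
  refine ⟨1 - 1 / ((m : ℝ) + 1), by rw [sub_lt_self_iff]; positivity, fun z => ?_⟩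
  obtain ⟨w, hw, hwz⟩ := hm (Set.mem_univ (proj Γ z))
  obtain ⟨γ, hγ⟩ : w ∈ MulAction.orbit Γ z := Quotient.exact hwz
  exact ⟨γ, by simp only at hγ; rw [hγ]; exact hw⟩

theorem norm_herm_le_two {n : ℕ} (z w : Ball n) : ‖herm z w‖ ≤ 2 := by
  rw [herm_eq_inner]
  have h := norm_sub_le (inner ℂ w.1 z.1) (1 : ℂ)
  have h2 := norm_inner_le_norm (𝕜 := ℂ) w.1 z.1
  rw [norm_one] at h
  nlinarith [norm_nonneg w.1, z.2, w.2, norm_nonneg z.1]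

theorem sqrt_ball_le_one {n : ℕ} (z : Ball n) : √(1 - ‖z.1‖ ^ 2) ≤ 1 := by
  rw [Real.sqrt_le_left zero_le_one]; nlinarith [norm_nonneg z.1]

/-- A point of the domain is no farther from p₀ than any of its translates, one of which lies in a
fixed smaller ball; but the distance to p₀ blows up at the sphere. -/
theorem exists_norm_le_of_mem_dirichlet {n : ℕ} (Γ : Subgroup (SU n)) [CompactSpace (BallQuot Γ)]
    (p₀ : Ball n) : ∃ R : ℝ, 0 ≤ R ∧ R < 1 ∧ ∀ z ∈ dirichlet Γ p₀, ‖z.1‖ ≤ R := by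
  obtain ⟨R, hR, h⟩ := exists_orbit_meets_ball Γ
  have hR0 : 0 < R := by
    obtain ⟨γ, hγ⟩ := h p₀
    exact (norm_nonneg _).trans_lt hγ
  have hp := sqrt_pos_ball p₀
  have hp1 := sqrt_ball_le_one p₀
  have hpp : 0 < 1 - ‖p₀.1‖ := sub_pos.2 p₀.2
  have hRs : 0 < √(1 - R ^ 2) := Real.sqrt_pos.2 (by nlinarith)
  -- T bounds `coshHalf` between p₀ and the ball of radius R; s below is the resulting lower bound
  -- for √(1 - ‖z‖²).
  set T := 2 / (√(1 - R ^ 2) * √(1 - ‖p₀.1‖ ^ 2)) with hT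
  have hT0 : 0 < T := by positivity
  set s := (1 - ‖p₀.1‖) / T with hs
  have hs0 : 0 < s := by positivity
  refine ⟨√(1 - s ^ 2), Real.sqrt_nonneg _, ?_, fun z hz => ?_⟩
  · rw [Real.sqrt_lt' one_pos]
    nlinarith
  obtain ⟨γ, hγ⟩ := h z
  have h1 := coshHalf_le_of_tau_le (hz γ⁻¹)
  have h2 : coshHalf z (γ⁻¹ • p₀) = coshHalf (γ • z) p₀ := by
    have := coshHalf_smul_smul (γ : SU n) z (γ⁻¹ • p₀)
    rw [← this]
    congr 1
    exact smul_inv_smul γ p₀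
  have h3 : coshHalf (γ • z) p₀ ≤ T := by
    rw [coshHalf, hT]
    have : √(1 - R ^ 2) ≤ √(1 - ‖(γ • z).1‖ ^ 2) := by
      gcongr
    gcongr
    exact norm_herm_le_two _ _
  have hz0 := sqrt_pos_ball z
  have h4 : (1 - ‖p₀.1‖) / √(1 - ‖z.1‖ ^ 2) ≤ coshHalf z p₀ := by
    rw [coshHalf]
    gcongr
    · exact le_norm_herm z p₀
    · exact mul_le_of_le_one_right hz0.le hp1
  have h5 : s ≤ √(1 - ‖z.1‖ ^ 2) := by
    rw [hs, div_le_iff₀ hT0]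
    have := h4.trans (h1.trans (h2.le.trans h3))
    rwa [div_le_iff₀ hz0, mul_comm] at this
  have h6 : s ^ 2 ≤ 1 - ‖z.1‖ ^ 2 := by
    rw [← Real.sq_sqrt (one_sub_norm_sq_pos z).le]
    gcongr
  apply Real.le_sqrt_of_sq_le
  linarith

/-! ### The Bergman kernel and its reproducing constant -/

/-- The value `n! / πⁿ` of the Bergman kernel at the centre. -/
def kernelConst (n : ℕ) : ℝ := n.factorial / Real.pi ^ n

theorem kernelConst_pos (n : ℕ) : 0 < kernelConst n := by
  unfold kernelConst
  positivity

theorem bergman_eq {n : ℕ} (z w : Ball n) :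
    bergman z w = (kernelConst n : ℂ) / (-herm z w) ^ (n + 1) := by
  simp [bergman, kernelConst]

theorem bergman_self {n : ℕ} (z : Ball n) :
    bergman z z = ((kernelConst n / (1 - ‖z.1‖ ^ 2) ^ (n + 1) : ℝ) : ℂ) := by
  rw [bergman_eq, herm_self, neg_neg]
  push_cast
  rfl

theorem bergmanDiag_eq {n : ℕ} (z : Ball n) :
    bergmanDiag z = kernelConst n / (1 - ‖z.1‖ ^ 2) ^ (n + 1) := by
  rw [bergmanDiag, bergman_self, Complex.ofReal_re]

theorem bergmanDiag_pos {n : ℕ} (z : Ball n) : 0 < bergmanDiag z := by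
  rw [bergmanDiag_eq]
  exact div_pos (kernelConst_pos n) (pow_pos (one_sub_norm_sq_pos z) _)

theorem sqrt_bergmanDiag {n : ℕ} (z : Ball n) :
    √(bergmanDiag z) = √(kernelConst n) / √(1 - ‖z.1‖ ^ 2) ^ (n + 1) := by
  rw [bergmanDiag_eq, Real.sqrt_div (kernelConst_pos n).le]
  congr 1
  rw [Real.sqrt_eq_iff_mul_self_eq_of_pos (pow_pos (sqrt_pos_ball z) _), ← mul_pow,
    Real.mul_self_sqrt (one_sub_norm_sq_pos z).le]

/-- The Jacobian's denominator is exactly what converts 1 - ‖Az‖² into 1 - ‖z‖². -/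
theorem norm_jac_mul_bergman {n : ℕ} (A : SU n) (z p : Ball n) :
    ‖jac A z‖ * ‖bergman (A • z) p‖ =
      √(bergmanDiag z) * √(bergmanDiag p) * (1 / coshHalf (A • z) p) ^ (n + 1) := by
  have hd := norm_pos_iff.2 (den_ne_zero A z.2)
  have hh : 0 < ‖herm (A • z) p‖ := (sub_pos.2 p.2).trans_le (le_norm_herm (A • z) p)
  have hs := sqrt_pos_ball (A • z)
  have hp := sqrt_pos_ball p
  have hK := kernelConst_pos n
  have hK2 : √(kernelConst n) * √(kernelConst n) = kernelConst n := Real.mul_self_sqrt hK.le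
  rw [sqrt_bergmanDiag, sqrt_bergmanDiag, jac, bergman_eq, coshHalf,
    ← sqrt_one_sub_norm_sq_smul A z]
  simp only [norm_div, norm_one, norm_pow, norm_neg, Complex.norm_real, Real.norm_of_nonneg hK.le]
  conv_lhs => rw [← hK2]
  simp only [div_pow, mul_pow]
  field_simp
  rw [one_pow]

theorem herm_origin_left {n : ℕ} (w : Ball n) : herm (origin n) w = -1 := by
  simp [herm, origin]

theorem herm_origin_right {n : ℕ} (w : Ball n) : herm w (origin n) = -1 := by
  simp [herm, origin]

theorem measurableEmbedding_ball (n : ℕ) :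
    MeasurableEmbedding (Subtype.val : Ball n → EuclideanSpace ℂ (Fin n)) :=
  MeasurableEmbedding.subtype_coe (measurableSet_lt measurable_norm measurable_const)

theorem lebesgue_apply {n : ℕ} (s : Set (Ball n)) :
    lebesgue n s = volume (Subtype.val '' s) :=
  (measurableEmbedding_ball n).comap_apply _ _

instance (n : ℕ) : IsFiniteMeasure (lebesgue n) := by
  refine ⟨?_⟩
  rw [lebesgue_apply]
  refine (measure_mono (t := Metric.ball 0 1) ?_).trans_lt measure_ball_lt_top
  rintro _ ⟨z, -, rfl⟩
  simpa using z.2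

theorem lebesgue_real_ball_pos {n : ℕ} {s : ℝ} (hs : 0 < s) (hs1 : s ≤ 1) :
    0 < (lebesgue n).real {z : Ball n | ‖z.1‖ < s} := by
  refine ENNReal.toReal_pos ?_ (measure_lt_top _ _).ne
  have : Subtype.val '' {z : Ball n | ‖z.1‖ < s} = Metric.ball 0 s := by
    ext x
    simp only [Set.mem_image, Set.mem_ofPred_eq, Subtype.exists, Metric.mem_ball, dist_zero_right]
    exact ⟨by rintro ⟨a, _, h, rfl⟩; exact h, fun h => ⟨x, h.trans_le hs1, h, rfl⟩⟩
  rw [lebesgue_apply, this]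
  exact (Metric.measure_ball_pos _ _ hs).ne'

/-- The weight is shifted by one because dV supplies one factor 𝒦(w,w), cancelling one of the k + 1
in the denominator. -/
theorem repConst_succ (n k : ℕ) :
    repConst n (k + 1) = ((1 / (kernelConst n *
      ∫ w : Ball n, (1 - ‖w.1‖ ^ 2) ^ ((n + 1) * k) ∂(lebesgue n)) : ℝ) : ℂ) := by
  have hK := (kernelConst_pos n).ne'
  have hKc : (kernelConst n : ℂ) ≠ 0 := by exact_mod_cast hK
  have h : ∀ w : Ball n, bergman (origin n) w ^ (k + 1) * bergman w (origin n) ^ (k + 1) /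
      bergman w w ^ (k + 1) * bergman w w =
      ((kernelConst n ^ (k + 2) * (1 - ‖w.1‖ ^ 2) ^ ((n + 1) * k) : ℝ) : ℂ) := by
    intro w
    have hw := (one_sub_norm_sq_pos w).ne'
    rw [bergman_self, bergman_eq, bergman_eq, herm_origin_left, herm_origin_right]
    simp only [neg_neg, one_pow, div_one]
    norm_cast
    rw [pow_mul, div_pow]
    field_simp
    ring
  rw [repConst]
  simp_rw [h]
  rw [integral_complex_ofReal, integral_const_mul, bergman_eq, herm_origin_left]
  simp only [neg_neg, one_pow, div_one]
  push_cast
  rw [pow_succ _ (k + 1), mul_assoc, div_mul_eq_div_div, div_self (pow_ne_zero _ hKc)]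

/-- On the ball of radius √(1 - y), of fixed positive volume, the integrand is at least y^{(n+1)k}.
As y can be taken near 1, growth is below every exponential rate. -/
theorem norm_repConst_le (n : ℕ) {y : ℝ} (hy : 0 < y) (hy1 : y < 1) :
    ∃ A : ℝ, 0 ≤ A ∧ ∀ k : ℕ, ‖repConst n (k + 1)‖ ≤ A / y ^ ((n + 1) * k) := by
  have hs : 0 < √(1 - y) := Real.sqrt_pos.2 (by linarith)
  have hs1 : √(1 - y) ≤ 1 := by rw [Real.sqrt_le_left zero_le_one]; linarith
  have hv := lebesgue_real_ball_pos (n := n) hs hs1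
  have hK := kernelConst_pos n
  refine ⟨1 / (kernelConst n * (lebesgue n).real {z : Ball n | ‖z.1‖ < √(1 - y)}),
    by positivity, fun k => ?_⟩
  have hint : Integrable (fun w : Ball n => (1 - ‖w.1‖ ^ 2) ^ ((n + 1) * k)) (lebesgue n) := by
    refine Integrable.of_bound (C := 1) (by fun_prop) (Filter.Eventually.of_forall fun w => ?_)
    have := one_sub_norm_sq_pos w
    rw [Real.norm_of_nonneg (by positivity)]
    exact pow_le_one₀ this.le (by nlinarith [norm_nonneg w.1])
  have hmeas : MeasurableSet {z : Ball n | ‖z.1‖ < √(1 - y)} :=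
    measurableSet_lt (by fun_prop) measurable_const
  have h1 : y ^ ((n + 1) * k) * (lebesgue n).real {z : Ball n | ‖z.1‖ < √(1 - y)} ≤
      ∫ w : Ball n, (1 - ‖w.1‖ ^ 2) ^ ((n + 1) * k) ∂(lebesgue n) := by
    refine (setIntegral_ge_of_const_le_real hmeas (measure_lt_top _ _).ne (fun w hw => ?_)
      hint.integrableOn).trans (setIntegral_le_integral hint
        (Filter.Eventually.of_forall fun w => (pow_pos (one_sub_norm_sq_pos w) _).le))
    gcongr
    have := (Real.lt_sqrt (norm_nonneg _)).1 hw
    linarith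
  have h0 : 0 < y ^ ((n + 1) * k) * (lebesgue n).real {z : Ball n | ‖z.1‖ < √(1 - y)} := by
    positivity
  rw [repConst_succ, Complex.norm_real, Real.norm_of_nonneg
    (one_div_nonneg.2 (mul_nonneg hK.le (h0.le.trans h1))), div_div]
  apply one_div_le_one_div_of_le (by positivity)
  calc _ = kernelConst n *
        (y ^ ((n + 1) * k) * (lebesgue n).real {z : Ball n | ‖z.1‖ < √(1 - y)}) := by ring
    _ ≤ _ := by gcongr

/-! ### The hermitian pairing of vector-valued functions -/

/-- The pairing `Fᵀ Ḡ` on `ℂᵐ` as a real bilinear map. -/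
def pairing (m : ℕ) : (Fin m → ℂ) →L[ℝ] (Fin m → ℂ) →L[ℝ] ℂ :=
  ∑ i, (ContinuousLinearMap.mul ℝ ℂ).bilinearComp (ContinuousLinearMap.proj i)
    ((Complex.conjCLE : ℂ →L[ℝ] ℂ).comp (ContinuousLinearMap.proj i))

theorem pairing_apply {m : ℕ} (F G : Fin m → ℂ) :
    pairing m F G = ∑ i, F i * starRingEnd ℂ (G i) := by
  simp [pairing]

theorem pairing_smul_smul {m : ℕ} (a b : ℂ) (F G : Fin m → ℂ) :
    pairing m (a • F) (b • G) = a * starRingEnd ℂ b * pairing m F G := by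
  simp only [pairing_apply, Finset.mul_sum, Pi.smul_apply, smul_eq_mul, map_mul]
  exact Finset.sum_congr rfl fun i _ => by ring

/-- ρ(γ') is the adjoint of ρ(γ'⁻¹), so the product of two columns is an entry of ρ(γ')ρ(γ⁻¹). -/
theorem pairing_col {G : Type*} [Group G] {m : ℕ} (ρ : G →* Matrix.unitaryGroup (Fin m) ℂ)
    (γ γ' : G) (r j : Fin m) (a b : ℂ) :
    pairing m ((ρ γ⁻¹ : Matrix (Fin m) (Fin m) ℂ).mulVec (Pi.single r a))
      ((ρ γ'⁻¹ : Matrix (Fin m) (Fin m) ℂ).mulVec (Pi.single j b)) =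
      a * starRingEnd ℂ b * (ρ (γ' * γ⁻¹) : Matrix (Fin m) (Fin m) ℂ) j r := by
  have h : (ρ γ' : Matrix (Fin m) (Fin m) ℂ) = star (ρ γ'⁻¹ : Matrix (Fin m) (Fin m) ℂ) := by
    rw [map_inv, Matrix.UnitaryGroup.inv_val, star_star]
  rw [pairing_apply, map_mul, Matrix.UnitaryGroup.mul_val, h, Matrix.mul_apply, Finset.mul_sum]
  refine Finset.sum_congr rfl fun i _ => ?_
  simp [Matrix.mulVec_single, Matrix.star_apply]
  ring

theorem norm_unitary_entry_le {m : ℕ} (U : Matrix.unitaryGroup (Fin m) ℂ) (i j : Fin m) :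
    ‖(U : Matrix (Fin m) (Fin m) ℂ) i j‖ ≤ 1 :=
  entry_norm_bound_of_unitary U.2 i j

/-! ### Estimates of Poincaré series -/

variable {n m : ℕ} {Γ : Subgroup (SU n)}

/-- The summand of index `γ` of `thetaPoint`. -/
def thetaTerm (Γ : Subgroup (SU n)) (ρ : Γ →* Matrix.unitaryGroup (Fin m) ℂ)
    (j : Fin m) (k : ℕ) (p z : Ball n) (γ : Γ) : Fin m → ℂ :=
  jac (γ : SU n) z ^ k •
    (ρ γ⁻¹ : Matrix (Fin m) (Fin m) ℂ).mulVec (Pi.single j (bergman (γ • z) p ^ k))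

theorem norm_jac_mul_bergman_pow (γ : Γ) (k : ℕ) (p z : Ball n) :
    ‖jac (γ : SU n) z ^ k * bergman (γ • z) p ^ k‖ =
      (√(bergmanDiag z) * √(bergmanDiag p)) ^ k *
        (1 / coshHalf (γ • z) p) ^ ((n + 1) * k) := by
  rw [← mul_pow, norm_pow, norm_mul, pow_mul, ← mul_pow]
  congr 1
  exact norm_jac_mul_bergman (γ : SU n) z p

theorem one_div_coshHalf_le (γ : Γ) {z p : Ball n} {R : ℝ} (hz : ‖z.1‖ ≤ R)
    (hp : ‖p.1‖ ≤ R) (hR : R < 1) :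
    1 / coshHalf (γ • z) p ≤ 3 / (1 - R) ^ 2 * (1 / (1 + ‖entries (γ : SU n)‖)) := by
  have h := le_coshHalf_smul (γ : SU n) hz hp hR
  have h0 : 0 < 1 - R := by linarith
  calc _ ≤ 1 / ((1 - R) ^ 2 / 3 * (1 + ‖entries (γ : SU n)‖)) :=
        one_div_le_one_div_of_le (by positivity) h
    _ = _ := by field_simp

theorem norm_thetaTerm_le (ρ : Γ →* Matrix.unitaryGroup (Fin m) ℂ)
    (j : Fin m) (k : ℕ) (p z : Ball n) (γ : Γ) :
    ‖thetaTerm Γ ρ j k p z γ‖ ≤ (√(bergmanDiag z) * √(bergmanDiag p)) ^ k *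
        (1 / coshHalf (γ • z) p) ^ ((n + 1) * k) := by
  rw [← norm_jac_mul_bergman_pow]
  refine (pi_norm_le_iff_of_nonneg (norm_nonneg _)).2 fun i => ?_
  simp only [thetaTerm, Matrix.mulVec_single, Pi.smul_apply, smul_eq_mul, Matrix.col_apply,
    MulOpposite.smul_eq_mul_unop, MulOpposite.unop_op, norm_mul]
  have := norm_unitary_entry_le (ρ γ⁻¹) i j
  gcongr
  exact mul_le_of_le_one_left (norm_nonneg _) this

/-- Since 1/cosh ≤ 1, the exponent may be lowered to N, giving a summable majorant independent of k.
-/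
theorem pow_one_div_coshHalf_le (γ : Γ) {z p : Ball n} {R : ℝ} (hz : ‖z.1‖ ≤ R)
    (hp : ‖p.1‖ ≤ R) (hR : R < 1) (N k : ℕ) (hk : N ≤ k) :
    (1 / coshHalf (γ • z) p) ^ ((n + 1) * k) ≤
      (3 / (1 - R) ^ 2) ^ N * (1 / (1 + ‖entries (γ : SU n)‖)) ^ N := by
  have h1 := one_le_coshHalf (γ • z) p
  rw [← mul_pow]
  have h2 : N ≤ (n + 1) * k := hk.trans (Nat.le_mul_of_pos_left _ (by lia))
  refine (pow_le_pow_of_le_one (by positivity) ((div_le_one (by linarith)).2 h1) h2).trans ?_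
  gcongr
  exact one_div_coshHalf_le γ hz hp hR

theorem summable_thetaTerm {N : ℕ}
    (hN : Summable fun γ : Γ => (1 / (1 + ‖entries (γ : SU n)‖)) ^ N)
    (ρ : Γ →* Matrix.unitaryGroup (Fin m) ℂ) (j : Fin m) {k : ℕ} (hk : N ≤ k) (p z : Ball n) :
    Summable (thetaTerm Γ ρ j k p z) := by
  have hR : max ‖z.1‖ ‖p.1‖ < 1 := max_lt z.2 p.2
  refine Summable.of_norm_bounded ((hN.mul_left
    ((3 / (1 - max ‖z.1‖ ‖p.1‖) ^ 2) ^ N)).mul_left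
      ((√(bergmanDiag z) * √(bergmanDiag p)) ^ k)) fun γ => ?_
  refine (norm_thetaTerm_le ρ j k p z γ).trans ?_
  gcongr
  exact pow_one_div_coshHalf_le γ (le_max_left _ _) (le_max_right _ _) hR N k hk

/-- Off-diagonal decay of the pairing of two summands. -/
theorem norm_pairing_thetaTerm_le (ρ : Γ →* Matrix.unitaryGroup (Fin m) ℂ) (r j : Fin m)
    {N k : ℕ} {z p q : Ball n} {R κ : ℝ} (hz : ‖z.1‖ ≤ R) (hp : ‖p.1‖ ≤ R)
    (hq : ‖q.1‖ ≤ R) (hR : R < 1) (hκ : 1 ≤ κ)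
    (h : ∀ η : Γ, (ρ η : Matrix (Fin m) (Fin m) ℂ) j r = 0 ∨ 2 * κ - 1 ≤ coshHalf (η • p) q)
    (γ γ' : Γ) :
    ‖pairing m (thetaTerm Γ ρ r (N + k) p z γ) (thetaTerm Γ ρ j (N + k) q z γ')‖ ≤
      (bergmanDiag z ^ (N + k) * √(bergmanDiag p) ^ (N + k) * √(bergmanDiag q) ^ (N + k) *
        ((3 / (1 - R) ^ 2) ^ (2 * N) * (1 / κ) ^ ((n + 1) * k))) *
        (1 / (1 + ‖entries (γ : SU n)‖)) ^ N * (1 / (1 + ‖entries (γ' : SU n)‖)) ^ N := by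
  have hz0 := bergmanDiag_pos z
  have h1R : 0 < 1 - R := by linarith
  have e : ‖pairing m (thetaTerm Γ ρ r (N + k) p z γ) (thetaTerm Γ ρ j (N + k) q z γ')‖ =
      ‖jac (γ : SU n) z ^ (N + k) * bergman (γ • z) p ^ (N + k)‖ *
      ‖jac (γ' : SU n) z ^ (N + k) * bergman (γ' • z) q ^ (N + k)‖ *
        ‖(ρ (γ' * γ⁻¹) : Matrix (Fin m) (Fin m) ℂ) j r‖ := by
    rw [thetaTerm, thetaTerm, pairing_smul_smul, pairing_col]
    simp only [norm_mul, RCLike.norm_conj]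
    ring
  rw [e]
  rcases h (γ' * γ⁻¹) with h0 | h0
  · rw [h0, norm_zero, mul_zero]
    positivity
  rw [norm_jac_mul_bergman_pow, norm_jac_mul_bergman_pow]
  -- The triangle inequality through z for the points γ⁻¹p and γ'⁻¹q, whose distance is that of
  -- γ'γ⁻¹p and q.
  have hC : κ ≤ coshHalf (γ • z) p * coshHalf (γ' • z) q := by
    have h1 := coshHalf_le z (γ⁻¹ • p) (γ'⁻¹ • q)
    have e1 : coshHalf z (γ⁻¹ • p) = coshHalf (γ • z) p := by
      rw [← coshHalf_smul_smul (γ : SU n)]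
      exact congrArg _ (smul_inv_smul γ p)
    have e2 : coshHalf z (γ'⁻¹ • q) = coshHalf (γ' • z) q := by
      rw [← coshHalf_smul_smul (γ' : SU n)]
      exact congrArg _ (smul_inv_smul γ' q)
    have e3 : coshHalf (γ⁻¹ • p) (γ'⁻¹ • q) = coshHalf ((γ' * γ⁻¹) • p) q := by
      rw [← coshHalf_smul_smul (γ' : SU n), mul_smul]
      exact congrArg _ (smul_inv_smul γ' q)
    rw [e1, e2, e3] at h1
    linarith
  set a := coshHalf (γ • z) p
  set b := coshHalf (γ' • z) q
  have ha : 1 ≤ a := one_le_coshHalf _ _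
  have hb : 1 ≤ b := one_le_coshHalf _ _
  -- The exponent N + k is split: N pays for summability over Γ, k for the decay in κ.
  have h3 : (1 / a) ^ ((n + 1) * (N + k)) * (1 / b) ^ ((n + 1) * (N + k)) ≤
      ((3 / (1 - R) ^ 2) ^ (2 * N) * (1 / κ) ^ ((n + 1) * k)) *
        ((1 / (1 + ‖entries (γ : SU n)‖)) ^ N * (1 / (1 + ‖entries (γ' : SU n)‖)) ^ N) := by
    have h4 : (1 / a) ^ ((n + 1) * N) ≤ _ := pow_one_div_coshHalf_le γ hz hp hR N N le_rfl
    have h5 : (1 / b) ^ ((n + 1) * N) ≤ _ := pow_one_div_coshHalf_le γ' hz hq hR N N le_rfl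
    have h6 : (1 / (a * b)) ^ ((n + 1) * k) ≤ (1 / κ) ^ ((n + 1) * k) := by gcongr
    calc _ = (1 / a) ^ ((n + 1) * N) * (1 / b) ^ ((n + 1) * N) *
          (1 / (a * b)) ^ ((n + 1) * k) := by
          rw [mul_add, pow_add, pow_add, ← one_div_mul_one_div, mul_pow]
          ring
      _ ≤ ((3 / (1 - R) ^ 2) ^ N * (1 / (1 + ‖entries (γ : SU n)‖)) ^ N) *
          ((3 / (1 - R) ^ 2) ^ N * (1 / (1 + ‖entries (γ' : SU n)‖)) ^ N) *
          (1 / κ) ^ ((n + 1) * k) := by gcongr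
      _ = _ := by ring
  have h7 := norm_unitary_entry_le (ρ (γ' * γ⁻¹)) j r
  have e4 : (bergmanDiag z) ^ (N + k) =
      √(bergmanDiag z) ^ (N + k) * √(bergmanDiag z) ^ (N + k) := by
    rw [← mul_pow, Real.mul_self_sqrt hz0.le]
  calc _ ≤ (√(bergmanDiag z) * √(bergmanDiag p)) ^ (N + k) * (1 / a) ^ ((n + 1) * (N + k)) *
        ((√(bergmanDiag z) * √(bergmanDiag q)) ^ (N + k) * (1 / b) ^ ((n + 1) * (N + k))) * 1 := by
        gcongr
    _ = bergmanDiag z ^ (N + k) * √(bergmanDiag p) ^ (N + k) * √(bergmanDiag q) ^ (N + k) *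
        ((1 / a) ^ ((n + 1) * (N + k)) * (1 / b) ^ ((n + 1) * (N + k))) := by
        rw [e4, mul_pow, mul_pow]
        ring
    _ ≤ _ := mul_le_mul_of_nonneg_left h3 (by positivity)
    _ = _ := by ring

theorem thetaPoint_eq (ρ : Γ →* Matrix.unitaryGroup (Fin m) ℂ) (j : Fin m) (k : ℕ) (p z : Ball n) :
    thetaPoint Γ ρ j k p z = repConst n k • ∑' γ, thetaTerm Γ ρ j k p z γ := rfl

theorem norm_pairing_thetaPoint_le {N : ℕ}
    (hN : Summable fun γ : Γ => (1 / (1 + ‖entries (γ : SU n)‖)) ^ N)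
    (ρ : Γ →* Matrix.unitaryGroup (Fin m) ℂ) (r j : Fin m)
    {k : ℕ} {z p q : Ball n} {R κ : ℝ} (hz : ‖z.1‖ ≤ R) (hp : ‖p.1‖ ≤ R)
    (hq : ‖q.1‖ ≤ R) (hR : R < 1) (hκ : 1 ≤ κ)
    (h : ∀ η : Γ, (ρ η : Matrix (Fin m) (Fin m) ℂ) j r = 0 ∨ 2 * κ - 1 ≤ coshHalf (η • p) q) :
    ‖pairing m (thetaPoint Γ ρ r (N + k) p z) (thetaPoint Γ ρ j (N + k) q z)‖ ≤
      ‖repConst n (N + k)‖ ^ 2 *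
      (bergmanDiag z ^ (N + k) * √(bergmanDiag p) ^ (N + k) * √(bergmanDiag q) ^ (N + k) *
        ((3 / (1 - R) ^ 2) ^ (2 * N) * (1 / κ) ^ ((n + 1) * k))) *
        (∑' γ : Γ, (1 / (1 + ‖entries (γ : SU n)‖)) ^ N) ^ 2 := by
  have hb := norm_bilin_tsum_le (pairing m)
    (summable_thetaTerm hN ρ r (Nat.le_add_right N k) p z)
    (summable_thetaTerm hN ρ j (Nat.le_add_right N k) q z) hN hN
    (norm_pairing_thetaTerm_le ρ r j hz hp hq hR hκ h)
  rw [thetaPoint_eq, thetaPoint_eq, pairing_smul_smul, norm_mul, norm_mul, RCLike.norm_conj, ← sq]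
  refine (mul_le_mul_of_nonneg_left hb (by positivity)).trans (le_of_eq ?_)
  ring

/-! ### Integration over the submanifolds and the fundamental domain -/

theorem bergmanDiag_rpow (p : Ball n) (k : ℕ) :
    bergmanDiag p ^ (-(k : ℝ) / 2) = (√(bergmanDiag p) ^ k)⁻¹ := by
  have h := bergmanDiag_pos p
  rw [Real.sqrt_eq_rpow, ← Real.rpow_natCast, ← Real.rpow_mul h.le, ← Real.rpow_neg h.le]
  congr 1
  ring

theorem norm_pairing_thetaSub_le {N qX qY : ℕ} {X Y : Set (Ball n)} (hX : MeasurableSet X)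
    (hY : MeasurableSet Y) {oX νX : FormField n qX} {oY νY : FormField n qY}
    (hνX : IntegrableOn (fun x : Ball n => density (ambient X) oX νX x.1) X μHE[qX])
    (hνY : IntegrableOn (fun x : Ball n => density (ambient Y) oY νY x.1) Y μHE[qY])
    (hN : Summable fun γ : Γ => (1 / (1 + ‖entries (γ : SU n)‖)) ^ N)
    (ρ : Γ →* Matrix.unitaryGroup (Fin m) ℂ) (r j : Fin m)
    {k : ℕ} {z : Ball n} {R κ : ℝ} (hz : ‖z.1‖ ≤ R) (hXR : ∀ p ∈ X, ‖p.1‖ ≤ R)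
    (hYR : ∀ q ∈ Y, ‖q.1‖ ≤ R) (hR : R < 1) (hκ : 1 ≤ κ)
    (h : ∀ p ∈ X, ∀ q ∈ Y, ∀ η : Γ,
      (ρ η : Matrix (Fin m) (Fin m) ℂ) j r = 0 ∨ 2 * κ - 1 ≤ coshHalf (η • p) q) :
    ‖pairing m (thetaSub Γ ρ X oX νX r (N + k) z) (thetaSub Γ ρ Y oY νY j (N + k) z)‖ ≤
      (‖repConst n (N + k)‖ ^ 2 *
      (bergmanDiag z ^ (N + k) *
        ((3 / (1 - R) ^ 2) ^ (2 * N) * (1 / κ) ^ ((n + 1) * k))) *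
        (∑' γ : Γ, (1 / (1 + ‖entries (γ : SU n)‖)) ^ N) ^ 2) *
      (∫ x in X, |density (ambient X) oX νX x.1| ∂μHE[qX]) *
      ∫ x in Y, |density (ambient Y) oY νY x.1| ∂μHE[qY] := by
  have h1R : 0 < 1 - R := by linarith
  have hz0 := bergmanDiag_pos z
  refine norm_bilin_integral_le (pairing m) (by positivity) (fun _ => abs_nonneg _)
    (fun _ => abs_nonneg _) hνX.abs hνY.abs ?_
  filter_upwards [ae_restrict_mem hX] with p hp
  filter_upwards [ae_restrict_mem hY] with q hq
  have hb := norm_pairing_thetaPoint_le (k := k) hN ρ r j hz (hXR p hp) (hYR q hq) hR hκ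
    (h p hp q hq)
  have hp0 : 0 < √(bergmanDiag p) := Real.sqrt_pos.2 (bergmanDiag_pos p)
  have hq0 : 0 < √(bergmanDiag q) := Real.sqrt_pos.2 (bergmanDiag_pos q)
  rw [bergmanDiag_rpow, bergmanDiag_rpow]
  simp only [map_smul, _root_.smul_apply, norm_smul, Real.norm_eq_abs, abs_inv, abs_pow,
    abs_of_pos hp0, abs_of_pos hq0]
  calc _ = |density (ambient X) oX νX p.1| * |density (ambient Y) oY νY q.1| *
        ((√(bergmanDiag p) ^ (N + k))⁻¹ * (√(bergmanDiag q) ^ (N + k))⁻¹) *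
        ‖pairing m (thetaPoint Γ ρ r (N + k) p z) (thetaPoint Γ ρ j (N + k) q z)‖ := by ring
    _ ≤ |density (ambient X) oX νX p.1| * |density (ambient Y) oY νY q.1| *
        ((√(bergmanDiag p) ^ (N + k))⁻¹ * (√(bergmanDiag q) ^ (N + k))⁻¹) *
        _ := mul_le_mul_of_nonneg_left hb (by positivity)
    _ = _ := by field_simp

/-- The weight 𝒦(z,z)⁻ᵏ cancels the growth of the pairing in z; the factor 𝒦(z,z) left over from dV
is bounded for ‖z‖ ≤ R, and the domain has finite Lebesgue measure. -/
theorem norm_petersson_le {N qX qY : ℕ} {X Y : Set (Ball n)} (hX : MeasurableSet X)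
    (hY : MeasurableSet Y) {oX νX : FormField n qX} {oY νY : FormField n qY}
    (hνX : IntegrableOn (fun x : Ball n => density (ambient X) oX νX x.1) X μHE[qX])
    (hνY : IntegrableOn (fun x : Ball n => density (ambient Y) oY νY x.1) Y μHE[qY])
    (hN : Summable fun γ : Γ => (1 / (1 + ‖entries (γ : SU n)‖)) ^ N)
    (ρ : Γ →* Matrix.unitaryGroup (Fin m) ℂ) (r j : Fin m)
    {k : ℕ} {p₀ : Ball n} {R κ : ℝ} (hR0 : 0 ≤ R) (hFR : ∀ z ∈ dirichlet Γ p₀, ‖z.1‖ ≤ R)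
    (hXF : X ⊆ dirichlet Γ p₀) (hYF : Y ⊆ dirichlet Γ p₀) (hR : R < 1) (hκ : 1 ≤ κ)
    (h : ∀ p ∈ X, ∀ q ∈ Y, ∀ η : Γ,
      (ρ η : Matrix (Fin m) (Fin m) ℂ) j r = 0 ∨ 2 * κ - 1 ≤ coshHalf (η • p) q) :
    ‖petersson Γ p₀ (N + k) (thetaSub Γ ρ X oX νX r (N + k)) (thetaSub Γ ρ Y oY νY j (N + k))‖ ≤
      ((3 / (1 - R) ^ 2) ^ (2 * N) * (∑' γ : Γ, (1 / (1 + ‖entries (γ : SU n)‖)) ^ N) ^ 2 *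
      (∫ x in X, |density (ambient X) oX νX x.1| ∂μHE[qX]) *
      (∫ x in Y, |density (ambient Y) oY νY x.1| ∂μHE[qY]) *
      (kernelConst n / (1 - R ^ 2) ^ (n + 1)) * (lebesgue n).real (dirichlet Γ p₀)) *
      (‖repConst n (N + k)‖ ^ 2 * (1 / κ) ^ ((n + 1) * k)) := by
  have hK := kernelConst_pos n
  have h1R : 0 < 1 - R := by linarith
  have h2R : 0 < 1 - R ^ 2 := by nlinarith
  refine (norm_setIntegral_le_of_norm_le_const (C := ((3 / (1 - R) ^ 2) ^ (2 * N) *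
      (∑' γ : Γ, (1 / (1 + ‖entries (γ : SU n)‖)) ^ N) ^ 2 *
      (∫ x in X, |density (ambient X) oX νX x.1| ∂μHE[qX]) *
      (∫ x in Y, |density (ambient Y) oY νY x.1| ∂μHE[qY]) *
      (kernelConst n / (1 - R ^ 2) ^ (n + 1))) *
      (‖repConst n (N + k)‖ ^ 2 * (1 / κ) ^ ((n + 1) * k)))
    (measure_lt_top _ _) fun z hz => ?_).trans (le_of_eq ?_)
  · have hb := norm_pairing_thetaSub_le (k := k) hX hY hνX hνY hN ρ r j (hFR z hz)
      (fun p hp => hFR p (hXF hp)) (fun q hq => hFR q (hYF hq)) hR hκ h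
    have hz0 := bergmanDiag_pos z
    have hzR := hFR z hz
    have hz1 : bergmanDiag z ≤ kernelConst n / (1 - R ^ 2) ^ (n + 1) := by
      rw [bergmanDiag_eq]
      gcongr
    have hIX : 0 ≤ ∫ x in X, |density (ambient X) oX νX x.1| ∂μHE[qX] :=
      integral_nonneg fun _ => abs_nonneg _
    have hIY : 0 ≤ ∫ x in Y, |density (ambient Y) oY νY x.1| ∂μHE[qY] :=
      integral_nonneg fun _ => abs_nonneg _
    rw [← pairing_apply, norm_mul, Complex.norm_real, Real.norm_of_nonneg (by positivity), inv_pow]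
    refine (mul_le_mul hb (mul_le_mul_of_nonneg_left hz1 (by positivity)) (by positivity)
      ((norm_nonneg _).trans hb)).trans (le_of_eq ?_)
    field_simp
  · ring

/-- The alternative on ρ(η)_{jr} is all that the two cases of the theorem have to supply. The
constants are fixed before m and ρ, which enter only through entries of modulus at most 1. -/
theorem exists_petersson_decay {l qX qY : ℕ} {X Y : Set (Ball n)} (hX : MeasurableSet X)
    (hY : MeasurableSet Y) {oX νX : FormField n qX} {oY νY : FormField n qY}
    (hνX : IntegrableOn (fun x : Ball n => density (ambient X) oX νX x.1) X μHE[qX])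
    (hνY : IntegrableOn (fun x : Ball n => density (ambient Y) oY νY x.1) Y μHE[qY])
    [DiscreteTopology Γ] [CompactSpace (BallQuot Γ)] {p₀ : Ball n}
    (hXF : X ⊆ dirichlet Γ p₀) (hYF : Y ⊆ dirichlet Γ p₀) {c : ℝ} (hc : 1 < c) :
    ∃ (C : ℝ) (k₀ : ℕ), ∀ (m : ℕ) (ρ : Γ →* Matrix.unitaryGroup (Fin m) ℂ) (r j : Fin m),
      (∀ p ∈ X, ∀ q ∈ Y, ∀ η : Γ,
        (ρ η : Matrix (Fin m) (Fin m) ℂ) j r = 0 ∨ c ≤ coshHalf (η • p) q) →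
      ∀ k : ℕ, k₀ ≤ k →
        ‖petersson Γ p₀ k (thetaSub Γ ρ X oX νX r k) (thetaSub Γ ρ Y oY νY j k)‖ ≤
          C / (k : ℝ) ^ l := by
  obtain ⟨N, hN⟩ := summable_entries Γ
  obtain ⟨R, hR0, hR, hFR⟩ := exists_norm_le_of_mem_dirichlet Γ p₀
  set κ := (c + 1) / 2 with hκdef
  have hκ : 1 < κ := by rw [hκdef]; linarith
  have hκ2 : 2 * κ - 1 = c := by rw [hκdef]; ring
  have hsq : 1 < √κ := by rw [Real.lt_sqrt zero_le_one]; linarith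
  have hssq : 1 < √(√κ) := by rw [Real.lt_sqrt zero_le_one]; linarith
  -- With y = κ^{-1/4} the square of the reproducing constant costs only κ^{(n+1)k/2}, up to a
  -- constant, leaving the rate θ = κ^{-(n+1)/2} < 1.
  set y := (√(√κ))⁻¹ with hy
  have hy0 : 0 < y := by positivity
  have hy1 : y < 1 := inv_lt_one_of_one_lt₀ hssq
  have hy2 : y ^ 2 = (√κ)⁻¹ := by rw [hy, inv_pow, Real.sq_sqrt (Real.sqrt_nonneg _)]
  obtain ⟨A, hA0, hA⟩ := norm_repConst_le n hy0 hy1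
  set θ := ((√κ)⁻¹) ^ (n + 1) with hθ
  have hθ0 : 0 < θ := by positivity
  have hθ1 : θ < 1 := pow_lt_one₀ (by positivity) (inv_lt_one_of_one_lt₀ hsq) (by lia)
  have hlim := tendsto_pow_const_mul_const_pow_of_abs_lt_one l
    (show |θ| < 1 by rwa [abs_of_pos hθ0])
  obtain ⟨D, hD⟩ := hlim.bddAbove_range
  set E := (3 / (1 - R) ^ 2) ^ (2 * N) * (∑' γ : Γ, (1 / (1 + ‖entries (γ : SU n)‖)) ^ N) ^ 2 *
      (∫ x in X, |density (ambient X) oX νX x.1| ∂μHE[qX]) *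
      (∫ x in Y, |density (ambient Y) oY νY x.1| ∂μHE[qY]) *
      (kernelConst n / (1 - R ^ 2) ^ (n + 1)) * (lebesgue n).real (dirichlet Γ p₀) with hE
  have hE0 : 0 ≤ E := by
    have hK := kernelConst_pos n
    have h1R : 0 < 1 - R := by linarith
    have h2R : 0 < 1 - R ^ 2 := by nlinarith
    have hIX : 0 ≤ ∫ x in X, |density (ambient X) oX νX x.1| ∂μHE[qX] :=
      integral_nonneg fun _ => abs_nonneg _
    have hIY : 0 ≤ ∫ x in Y, |density (ambient Y) oY νY x.1| ∂μHE[qY] :=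
      integral_nonneg fun _ => abs_nonneg _
    positivity
  -- The power of κ restores the N factors spent on summability, and D bounds kˡθᵏ. Starting at N +
  -- 1 keeps the weight positive, as `norm_repConst_le` requires.
  refine ⟨E * (A ^ 2 * κ ^ ((n + 1) * N)) * D, N + 1, fun m ρ r j h k hk => ?_⟩
  obtain ⟨k, rfl⟩ := Nat.exists_eq_add_of_le hk
  rw [← hκ2] at h
  have hb := norm_petersson_le (k := k + 1) hX hY hνX hνY hN ρ r j hR0 hFR hXF hYF hR hκ.le h
  have ek : N + (k + 1) = N + 1 + k := by ring
  rw [ek, ← hE] at hb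
  refine hb.trans ?_
  have hk0 : (0 : ℝ) < ((N + 1 + k : ℕ) : ℝ) := by positivity
  have hrep : ‖repConst n (N + 1 + k)‖ ≤ A / y ^ ((n + 1) * (N + 1 + k)) := by
    have e : N + 1 + k = (N + k) + 1 := by ring
    rw [e]
    refine (hA (N + k)).trans ?_
    exact div_le_div_of_nonneg_left hA0 (by positivity)
      (pow_le_pow_of_le_one hy0.le hy1.le (Nat.mul_le_mul_left _ (Nat.le_succ _)))
  have hκ0 : 0 < κ := by linarith
  have hmain : ‖repConst n (N + 1 + k)‖ ^ 2 * (1 / κ) ^ ((n + 1) * (k + 1)) ≤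
      A ^ 2 * κ ^ ((n + 1) * N) * θ ^ (N + 1 + k) := by
    have e2 : θ ^ (N + 1 + k) =
        (1 / y ^ ((n + 1) * (N + 1 + k))) ^ 2 * (1 / κ) ^ ((n + 1) * (N + 1 + k)) := by
      have e3 : (1 / y) ^ 2 * (1 / κ) = (√κ)⁻¹ := by
        rw [one_div_pow, hy2, one_div, inv_inv, mul_one_div, Real.sqrt_div_self', one_div]
      rw [hθ, ← pow_mul, ← e3, mul_pow, ← one_div_pow, pow_right_comm]
    calc _ ≤ (A / y ^ ((n + 1) * (N + 1 + k))) ^ 2 * (1 / κ) ^ ((n + 1) * (k + 1)) := by gcongr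
      _ = _ := by
        rw [e2]
        have : (n + 1) * (N + 1 + k) = (n + 1) * N + (n + 1) * (k + 1) := by ring
        rw [this, pow_add (1 / κ), one_div_pow κ ((n + 1) * N)]
        field_simp
  have hDk : ((N + 1 + k : ℕ) : ℝ) ^ l * θ ^ (N + 1 + k) ≤ D := hD ⟨N + 1 + k, rfl⟩
  rw [le_div_iff₀ (by positivity)]
  calc _ ≤ E * (A ^ 2 * κ ^ ((n + 1) * N) * θ ^ (N + 1 + k)) * ((N + 1 + k : ℕ) : ℝ) ^ l := by
        gcongr
    _ = E * (A ^ 2 * κ ^ ((n + 1) * N)) * (((N + 1 + k : ℕ) : ℝ) ^ l * θ ^ (N + 1 + k)) := by ring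
    _ ≤ _ := by gcongr

end BallQuotient

end

theorem theorem4p1 (n : ℕ) (hn : 1 ≤ n) (Γ : Subgroup (BallQuotient.SU n))
    (hdiscrete : DiscreteTopology Γ) (hcompact : CompactSpace (BallQuotient.BallQuot Γ))
    (hfree : ∀ (γ : Γ) (z : BallQuotient.Ball n), γ • z = z →
      ∀ w : BallQuotient.Ball n, γ • w = w)
    (p₀ : BallQuotient.Ball n)
    (qX qY : ℕ) (X' Y' : Set (BallQuotient.BallQuot Γ)) (X Y : Set (BallQuotient.Ball n))
    (oX νX : BallQuotient.FormField n qX) (oY νY : BallQuotient.FormField n qY)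
    (hX : BallQuotient.IsSubmanifoldWithForm Γ p₀ qX X' X oX νX)
    (hY : BallQuotient.IsSubmanifoldWithForm Γ p₀ qY Y' Y oY νY) :
    (0 < BallQuotient.setDist (BallQuotient.saturation Γ X \ X) Y →
      ∀ l : ℕ, ∃ (C : ℝ) (k₀ : ℕ), ∀ (m : ℕ) (ρ : Γ →* Matrix.unitaryGroup (Fin m) ℂ),
        (∀ γ : Γ, (∀ w : BallQuotient.Ball n, γ • w = w) → ρ γ = 1) →
        ∀ r j : Fin m, r ≠ j → ∀ k : ℕ, k₀ ≤ k →
          ‖BallQuotient.petersson Γ p₀ k (BallQuotient.thetaSub Γ ρ X oX νX r k)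
            (BallQuotient.thetaSub Γ ρ Y oY νY j k)‖ ≤ C / (k : ℝ) ^ l) ∧
    (0 < BallQuotient.setDist (BallQuotient.saturation Γ X) Y →
      ∀ l : ℕ, ∃ (C : ℝ) (k₀ : ℕ), ∀ (m : ℕ) (ρ : Γ →* Matrix.unitaryGroup (Fin m) ℂ),
        ∀ r j : Fin m, ∀ k : ℕ, k₀ ≤ k →
          ‖BallQuotient.petersson Γ p₀ k (BallQuotient.thetaSub Γ ρ X oX νX r k)
            (BallQuotient.thetaSub Γ ρ Y oY νY j k)‖ ≤ C / (k : ℝ) ^ l) := by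
  have hXm := BallQuotient.IsSubmanifold.measurableSet hX.submanifold
  have hYm := BallQuotient.IsSubmanifold.measurableSet hY.submanifold
  have hXF : X ⊆ BallQuotient.dirichlet Γ p₀ := hX.eq_inter.le.trans Set.inter_subset_right
  have hYF : Y ⊆ BallQuotient.dirichlet Γ p₀ := hY.eq_inter.le.trans Set.inter_subset_right
  refine ⟨fun hdist l => ?_, fun hdist l => ?_⟩
  · obtain ⟨C, k₀, h⟩ := BallQuotient.exists_petersson_decay (l := l) hXm hYm hX.integrable
      hY.integrable hXF hYF (Real.one_lt_cosh.2 (half_pos hdist).ne')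
    refine ⟨C, k₀, fun m ρ hρ r j hrj => h m ρ r j fun p hp q hq η => ?_⟩
    -- If ηp returns to X, it equals p and ρ(η) = 1 has zero off-diagonal entry; if not, ηp lies in
    -- X̃ \ X and is far from q.
    by_cases hη : η • p ∈ X
    · left
      have hproj : BallQuotient.proj Γ (η • p) = BallQuotient.proj Γ p :=
        Quotient.sound ⟨η, rfl⟩
      rw [hρ η (hfree η p (hX.bijOn.injOn hη hp hproj))]
      exact Matrix.one_apply_ne hrj.symm
    · right
      exact BallQuotient.cosh_half_le_coshHalf hdist.le
        (BallQuotient.setDist_le ⟨⟨η, p, hp, rfl⟩, hη⟩ hq)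
  · obtain ⟨C, k₀, h⟩ := BallQuotient.exists_petersson_decay (l := l) hXm hYm hX.integrable
      hY.integrable hXF hYF (Real.one_lt_cosh.2 (half_pos hdist).ne')
    refine ⟨C, k₀, fun m ρ r j => h m ρ r j fun p hp q hq η => Or.inr ?_⟩
    exact BallQuotient.cosh_half_le_coshHalf hdist.le
      (BallQuotient.setDist_le ⟨η, p, hp, rfl⟩ hq)
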